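/- **Conventions.** $\mathbb P^m$ denotes complex projective space. A camera is a real $3\times 4$ matrix $P$ of rank $3$; its center is the point of $\mathbb P^3$ given by its kernel. Let $n\ge 2$. A configuration $(\mathbf P,X)$ consists of $n$ cameras $\mathbf P=(P_1,\dots,P_n)$ with pairwise distinct centers and a set $X\subseteq\mathbb P^3$. A point $x$ has image $u\in\mathbb P^2$ under $P_i$ if $u=P_i(x)$, where the center of $P_i$ is allowed to have any image under $P_i$ (closure of the graph of the projection). $(\mathbf P,X)$ is a reconstruction of $S\subseteq(\mathbb P^2)^n$ if every $s\in S$ is a tuple of images of some $x\in X$, and every $x\in X$ has a tuple of images in $S$. Configurations $(\mathbf P,X)$, $(\mathbf Q,Y)$ are equivalent if some $H\in \mathrm{PGL}(4)$ satisfies $H(X)=Y$ and $P_iH^{-1}=Q_i$ (up to scale) for all $i$; they are conjugate if they are nonequivalent reconstructions of the same set $S$, and non-trivially conjugate if moreover, for all $i\ne j$, the fundamental matrices of $(P_i,P_j)$ and $(Q_i,Q_j)$ differ (as matrices up to scale). A configuration is (non-trivially) critical if it has a (non-trivially) conjugate configuration. For curves $C,D$ we say that $(\mathbf P,C)$ and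 $(\mathbf Q,D)$ are conjugate along the curves if they are non-trivially conjugate, and for every $X\subseteq C$ there is $Y\subseteq D$, and for every $Y\subseteq D$ there is $X\subseteq C$, such that $(\mathbf P,X)$ and $(\mathbf Q,Y)$ are non-trivially conjugate. All curves are real: a rational quartic is the image of $\mathbb P^1$ under four linearly independent real binary quartic forms without common zero (so it spans $\mathbb P^3$); it is smooth if this parametrization is a closed embedding, and singular otherwise. A twisted cubic is the image of $\mathbb P^1$ under four linearly independent real binary cubic forms. A secant line of a twisted cubic is a line spanned by two distinct (possibly complex) points of it, or a tangent line of it. **Proposition.** Let $n\ge2$. 1. Let $C$ be a smooth rational quartic and $\mathbf P$ an $n$-tuple of cameras with centers on $C$. Then $(\mathbf P,X)$ is non-trivially critical for every $X\subseteq C$. Moreover there are a twisted cubic $D$, a line $L$ with $L\cap D=\emptyset$ and cameras $\mathbf Q$ with centers on $L$ such that $(\mathbf P,C)$ and $(\mathbf Q,D)$ are conjugate along the curves. 2. Let $D$ be a twisted cubic, $L$ a line with $L\cap D=\emptyset$ and $\mathbf Q$ an $n$-tuple of cameras with centers on $L$. Then $(\mathbf Q,Y)$ is non-trivially critical for every $Y\subseteq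 D$. Moreover there are a smooth rational quartic $C$ and cameras $\mathbf P$ with centers on $C$ such that $(\mathbf Q,D)$ and $(\mathbf P,C)$ are conjugate along the curves. 3. Let $C$ be a singular rational quartic and $\mathbf P$ an $n$-tuple of cameras with centers on $C$. Then $(\mathbf P,X)$ is non-trivially critical for every $X\subseteq C$. If moreover no camera center is an isolated real point of $C$ (a node with complex conjugate branches), i.e. all centers are images of real points of $\mathbb P^1$, then there are a twisted cubic $D$, a secant line $L$ of $D$ and cameras $\mathbf Q$ with centers on $L$, at most one of them on $D$, such that $(\mathbf P,C)$ and $(\mathbf Q,D)$ are conjugate along the curves. 4. Let $D$ be a twisted cubic, $L$ a secant line of $D$ and $\mathbf Q$ an $n$-tuple of cameras with centers on $L$. Then $(\mathbf Q,Y)$ is critical for every $Y\subseteq D$. If $n\le3$ or at most one camera center lies on $D$, then $(\mathbf Q,Y)$ is non-trivially critical for every $Y\subseteq D$. If at most one camera center lies on $D$, then there are a singular rational quartic $C$ and cameras $\mathbf P$ whose centers are images of real points of $\mathbb P^1$ on $C$, such that $(\mathbf Q,D)$ and $(\mathbf P,C)$ are conjugate along the curves. -/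

import Mathlib

open scoped LinearAlgebra.Projectivization

noncomputable section

/-- Complex projective 3-space (space points). -/
abbrev P3 : Type := ℙ ℂ (Fin 4 → ℂ)

/-- Complex projective plane (image points). -/
abbrev P2 : Type := ℙ ℂ (Fin 3 → ℂ)

/-! ### Cameras -/

/-- A (real projective pinhole) camera: a real `3 × 4` matrix of full rank. -/
structure Camera where
  mat : Matrix (Fin 3) (Fin 4) ℝ
  rank_eq : mat.rank = 3

/-- The linear map `ℂ⁴ → ℂ³` given by the camera matrix. -/
def Camera.toLin (P : Camera) : (Fin 4 → ℂ) →ₗ[ℂ] (Fin 3 → ℂ) :=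
  (P.mat.map Complex.ofReal).mulVecLin

theorem Camera.exists_ker (P : Camera) : ∃ v : Fin 4 → ℂ, v ≠ 0 ∧ P.toLin v = 0 := by
  have h : P.toLin.ker ≠ ⊥ := LinearMap.ker_ne_bot_of_finrank_lt (by simp)
  obtain ⟨v, hv, h0⟩ := Submodule.exists_mem_ne_zero_of_ne_bot h
  exact ⟨v, h0, hv⟩

/-- The camera center: the point of `ℙ³` given by the kernel of the camera matrix
(a line in `ℂ⁴`, see `Camera.toLin_eq_zero_iff`). -/
def Camera.center (P : Camera) : P3 :=
  Projectivization.mk ℂ P.exists_ker.choose P.exists_ker.choose_spec.1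

/-- An `n`-tuple of cameras with pairwise distinct camera centers. -/
structure CameraTuple (n : ℕ) where
  cam : Fin n → Camera
  distinct : Function.Injective fun i => (cam i).center

/-- All camera centers lie in `C`. -/
def CameraTuple.CentersIn {n : ℕ} (P : CameraTuple n) (C : Set P3) : Prop :=
  ∀ i, (P.cam i).center ∈ C

theorem Camera.finrank_ker (P : Camera) : Module.finrank ℂ P.toLin.ker = 1 := by
  have h3 : (P.mat.map Complex.ofReal).rank = 3 := by
    have hsurj : Function.Surjective P.mat.mulVecLin := by
      rw [← LinearMap.range_eq_top]
      apply Submodule.eq_top_of_finrank_eq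
      have := P.rank_eq
      rw [Matrix.rank] at this
      simpa using this
    choose g hg using fun b : Fin 3 => hsurj (Pi.single b 1)
    have hmul : P.mat * (Matrix.of fun a b => g b a) = 1 := by
      ext a b
      have := congrFun (hg b) a
      simpa [Matrix.mul_apply, Matrix.mulVec, dotProduct, Matrix.one_apply, Pi.single_apply]
        using this
    have hmulC := congrArg (fun M : Matrix (Fin 3) (Fin 3) ℝ => M.map Complex.ofRealHom) hmul
    simp only [Matrix.map_mul] at hmulC
    apply le_antisymm
    · simpa using Matrix.rank_le_height (P.mat.map Complex.ofReal)
    · have h1 := Matrix.rank_mul_le_left (P.mat.map Complex.ofRealHom)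
        ((Matrix.of fun a b => g b a).map Complex.ofRealHom)
      rw [hmulC, Matrix.map_one _ (map_zero _) (map_one _), Matrix.rank_one] at h1
      rw [Fintype.card_fin] at h1
      exact h1
  have h4 := LinearMap.finrank_range_add_finrank_ker (P.mat.map Complex.ofReal).mulVecLin
  rw [Matrix.rank] at h3
  rw [h3, Module.finrank_fin_fun] at h4
  change Module.finrank ℂ (P.mat.map Complex.ofReal).mulVecLin.ker = 1
  omega

theorem Camera.toLin_eq_zero_iff (P : Camera) (x : P3) : P.toLin x.rep = 0 ↔ x = P.center := by
  have hc := P.exists_ker.choose_spec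
  constructor
  · intro hx
    have h1 := P.finrank_ker
    obtain ⟨c, hcx⟩ := (finrank_eq_one_iff_of_nonzero' (⟨_, hc.2⟩ : P.toLin.ker)
      (by simpa [Subtype.ext_iff] using hc.1)).1 h1 ⟨x.rep, hx⟩
    rw [← x.mk_rep, Camera.center, Projectivization.mk_eq_mk_iff']
    exact ⟨c, congrArg Subtype.val hcx⟩
  · rintro rfl
    obtain ⟨a, ha⟩ := Projectivization.exists_smul_eq_mk_rep ℂ _ hc.1
    rw [Camera.center, ← ha]
    have h2 := hc.2
    simp only [Units.smul_def, map_smul, h2, smul_zero]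

/-! ### Images, reconstructions, conjugate and critical configurations

A configuration is a tuple of cameras `P` together with a set `X` of space points. -/

/-- `u` is an image of `x` under `P`.  If `x` is not the camera center this says `u = P(x)`;
the camera center itself is allowed to have any image (closure of the graph of the projection). -/
def Camera.Sees (P : Camera) (x : P3) (u : P2) : Prop :=
  P.toLin x.rep ∈ u.submodule

/-- `(P, X)` is a reconstruction of the set `S ⊆ (ℙ²)ⁿ`: the points of `S` are exactly images,
under the joint camera map, of the points of `X`. -/
def IsReconstruction {n : ℕ} (P : CameraTuple n) (X : Set P3) (S : Set (Fin n → P2)) : Prop :=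
  (∀ s ∈ S, ∃ x ∈ X, ∀ i, (P.cam i).Sees x (s i)) ∧
  (∀ x ∈ X, ∃ s ∈ S, ∀ i, (P.cam i).Sees x (s i))

/-- Two configurations are equivalent if some `H ∈ PGL(4)` satisfies `H(X) = Y` and
`Pᵢ H⁻¹ = Qᵢ` (as projective maps, that is up to a nonzero scalar) for all `i`. -/
def Equivalent {n : ℕ} (P : CameraTuple n) (X : Set P3) (Q : CameraTuple n) (Y : Set P3) : Prop :=
  ∃ H : (Fin 4 → ℂ) ≃ₗ[ℂ] (Fin 4 → ℂ),
    Projectivization.map H.toLinearMap H.injective '' X = Y ∧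
    ∀ i, ∃ c : ℂ, c ≠ 0 ∧ ∀ v, (P.cam i).toLin v = c • (Q.cam i).toLin (H v)

/-- Conjugate configurations: nonequivalent reconstructions of the same set. -/
def Conjugate {n : ℕ} (P : CameraTuple n) (X : Set P3) (Q : CameraTuple n) (Y : Set P3) : Prop :=
  (∃ S, IsReconstruction P X S ∧ IsReconstruction Q Y S) ∧ ¬ Equivalent P X Q Y

/-- A configuration is critical if it has a conjugate configuration. -/
def IsCritical {n : ℕ} (P : CameraTuple n) (X : Set P3) : Prop :=
  ∃ (Q : CameraTuple n) (Y : Set P3), Conjugate P X Q Y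

/-- The bilinear form `xᵀ F y = det [P x 0; Q 0 y]` of a pair of cameras. -/
def fundamentalForm (P Q : Camera) (x y : Fin 3 → ℝ) : ℝ :=
  Matrix.det
    !![P.mat 0 0, P.mat 0 1, P.mat 0 2, P.mat 0 3, x 0, 0;
       P.mat 1 0, P.mat 1 1, P.mat 1 2, P.mat 1 3, x 1, 0;
       P.mat 2 0, P.mat 2 1, P.mat 2 2, P.mat 2 3, x 2, 0;
       Q.mat 0 0, Q.mat 0 1, Q.mat 0 2, Q.mat 0 3, 0, y 0;
       Q.mat 1 0, Q.mat 1 1, Q.mat 1 2, Q.mat 1 3, 0, y 1;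
       Q.mat 2 0, Q.mat 2 1, Q.mat 2 2, Q.mat 2 3, 0, y 2]

/-- The fundamental matrix of a pair of cameras. -/
def fundamentalMatrix (P Q : Camera) : Matrix (Fin 3) (Fin 3) ℝ :=
  Matrix.of fun a b => fundamentalForm P Q (Pi.single a 1) (Pi.single b 1)

/-- No pair of cameras of `P` has the same fundamental matrix (up to scale) as the
corresponding pair of cameras of `Q`. -/
def FundamentalMatricesDiffer {n : ℕ} (P Q : CameraTuple n) : Prop :=
  ∀ i j, i ≠ j → ¬ ∃ c : ℝ, c ≠ 0 ∧
    fundamentalMatrix (Q.cam i) (Q.cam j) = c • fundamentalMatrix (P.cam i) (P.cam j)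

/-- Conjugate configurations all of whose corresponding fundamental matrices differ. -/
def NonTriviallyConjugate {n : ℕ} (P : CameraTuple n) (X : Set P3)
    (Q : CameraTuple n) (Y : Set P3) : Prop :=
  Conjugate P X Q Y ∧ FundamentalMatricesDiffer P Q

/-- A non-trivial critical configuration. -/
def IsNonTriviallyCritical {n : ℕ} (P : CameraTuple n) (X : Set P3) : Prop :=
  ∃ (Q : CameraTuple n) (Y : Set P3), NonTriviallyConjugate P X Q Y

/-- The configurations with cameras `P` and points on `C` are conjugate to the configurations with
cameras `Q` and points on `D`: this holds for the full point sets `C` and `D`, and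
for every set of points on one of them there is a conjugate set of points on the other. -/
def ConjugateAlong {n : ℕ} (P : CameraTuple n) (C : Set P3)
    (Q : CameraTuple n) (D : Set P3) : Prop :=
  NonTriviallyConjugate P C Q D ∧
  (∀ X ⊆ C, ∃ Y ⊆ D, NonTriviallyConjugate P X Q Y) ∧
  (∀ Y ⊆ D, ∃ X ⊆ C, NonTriviallyConjugate P X Q Y)

/-! ### Real rational curves in `ℙ³` -/

/-- All monomials of degree `d` in two variables. -/
def veronese (d : ℕ) (z : Fin 2 → ℂ) : Fin (d + 1) → ℂ :=
  fun k => z 0 ^ (k : ℕ) * z 1 ^ (d - (k : ℕ))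

/-- The map `ℂ² → ℂ⁴` given by four real binary forms of degree `d`; the rows of `A` are their
coefficients. -/
def paramMap {d : ℕ} (A : Matrix (Fin 4) (Fin (d + 1)) ℝ) (z : Fin 2 → ℂ) : Fin 4 → ℂ :=
  (A.map Complex.ofReal).mulVec (veronese d z)

/-- The (complex) curve in `ℙ³` parametrized by `ℙ¹` through the forms `A`. -/
def curve {d : ℕ} (A : Matrix (Fin 4) (Fin (d + 1)) ℝ) : Set P3 :=
  {x | ∃ z : Fin 2 → ℂ, z ≠ 0 ∧ ∃ h : paramMap A z ≠ 0, x = Projectivization.mk ℂ (paramMap A z) h}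

/-- The image of the real projective line under the parametrization. -/
def realBranch {d : ℕ} (A : Matrix (Fin 4) (Fin (d + 1)) ℝ) : Set P3 :=
  {x | ∃ z : Fin 2 → ℝ, z ≠ 0 ∧ ∃ h : paramMap A (fun i => (z i : ℂ)) ≠ 0,
    x = Projectivization.mk ℂ (paramMap A (fun i => (z i : ℂ))) h}

/-- A real rational quartic spanning `ℙ³`: four linearly independent binary quartic forms without
common zero.  (Spanning `ℙ³` forces the parametrization to be birational onto its image.) -/
def IsRationalQuartic (A : Matrix (Fin 4) (Fin (4 + 1)) ℝ) : Prop :=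
  A.rank = 4 ∧ ∀ z : Fin 2 → ℂ, z ≠ 0 → paramMap A z ≠ 0

/-- The parametrization `ℙ¹ → ℙ³` is a closed embedding: it is injective and immersive
(for a homogeneous map, the latter means that its differential is injective off the origin). -/
def IsEmbeddedCurve {d : ℕ} (A : Matrix (Fin 4) (Fin (d + 1)) ℝ) : Prop :=
  (∀ z w : Fin 2 → ℂ, z ≠ 0 → w ≠ 0 →
    (∃ c : ℂ, c ≠ 0 ∧ paramMap A z = c • paramMap A w) → ∃ c : ℂ, c ≠ 0 ∧ z = c • w) ∧
  (∀ z : Fin 2 → ℂ, z ≠ 0 → Function.Injective (fderiv ℂ (paramMap A) z))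

/-- A smooth rational quartic. -/
def IsSmoothRationalQuartic (A : Matrix (Fin 4) (Fin (4 + 1)) ℝ) : Prop :=
  IsRationalQuartic A ∧ IsEmbeddedCurve A

/-- A singular rational quartic. -/
def IsSingularRationalQuartic (A : Matrix (Fin 4) (Fin (4 + 1)) ℝ) : Prop :=
  IsRationalQuartic A ∧ ¬ IsEmbeddedCurve A

/-- A twisted cubic: four linearly independent binary cubic forms. -/
def IsTwistedCubic (B : Matrix (Fin 4) (Fin (3 + 1)) ℝ) : Prop :=
  B.rank = 4

/-! ### Lines -/

/-- The points of `ℙ³` on the linear subspace given by `L`. -/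
def linePoints (L : Submodule ℂ (Fin 4 → ℂ)) : Set P3 :=
  {x | x.submodule ≤ L}

/-- `L` is a line in `ℙ³`. -/
def IsLine (L : Submodule ℂ (Fin 4 → ℂ)) : Prop :=
  Module.finrank ℂ L = 2

/-- `L` is spanned by two points of the curve, or is tangent to it. -/
def IsSecantLine {d : ℕ} (B : Matrix (Fin 4) (Fin (d + 1)) ℝ)
    (L : Submodule ℂ (Fin 4 → ℂ)) : Prop :=
  IsLine L ∧
  ((∃ z w : Fin 2 → ℂ, LinearIndependent ℂ ![z, w] ∧
      L = Submodule.span ℂ {paramMap B z, paramMap B w}) ∨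
   (∃ z : Fin 2 → ℂ, z ≠ 0 ∧
      L = LinearMap.range (fderiv ℂ (paramMap B) z).toLinearMap))

/-- At most one of the camera centers lies in `C`. -/
def CameraTuple.AtMostOneCenterIn {n : ℕ} (P : CameraTuple n) (C : Set P3) : Prop :=
  ∀ i j, (P.cam i).center ∈ C → (P.cam j).center ∈ C → i = j

end

/-! A rational quartic is the projection of the rational normal quartic in `ℙ⁴` from a real point
`k` spanning the kernel of its coefficient matrix `A`. Everything is read off from `k` and from
contraction of dual forms with the linear form vanishing at `w`, which sends the degree 4 Veronese
vector of `z` to `lin w z` times the one of degree 3 (`con_ver`). If a camera `P` has its center at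
the real parameter `w` of the quartic, then `P.mat * A` kills the kernel of the contraction at `w`.
Hence `P.mat * A = Q.mat * B * shift 3 w` for a camera `Q` on a twisted cubic `B`. Evaluated at
Veronese vectors, this says that corresponding points of quartic and cubic have the same images
(`companion_image`); evaluated at `k`, it says that the center of `Q` is the contraction of `k` at
`w` (`companion_center`). So all centers on the cubic side lie on the line of contractions of `k`.
Conversely, a real line disjoint from or secant to the cubic arises from some `k`, and the same
factorization gives the cameras of the quartic. The quartic has a base-point-free parametrization
iff `k` is off the rational normal curve, and is singular iff `k` is on a secant or tangent line,
iff the line of contractions meets the cubic (`isRationalQuartic_iff_nondegenerate`,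
`isEmbeddedCurve_iff`, `disjoint_conLine_iff`). Fundamental matrices are told apart by epipoles
(`distinguishable_of_epipole`, `companion_distinguishable`); this also excludes equivalence. Two
situations lie outside this correspondence. From an isolated real point the quartic projects to a
conic, which is also a projection of the cubic from any of its points. If two centers lie on the
cubic, both are moved along it while the points and the remaining cameras stay fixed
(`exists_reprojected_cameras`). -/

/-! ### Real matrices and their complexifications -/

/-- The complexification of a real vector. -/
def cx {ι : Type*} (v : ι → ℝ) : ι → ℂ := fun i => (v i : ℂ)

theorem cx_mulVec {m n : Type*} [Fintype n] (M : Matrix m n ℝ) (v : n → ℝ) :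
    cx (M.mulVec v) = (M.map Complex.ofReal).mulVec (cx v) := by
  ext i
  simp [cx, Matrix.mulVec, dotProduct]

theorem map_ofReal_mul {l m n : Type*} [Fintype m] (M : Matrix l m ℝ) (N : Matrix m n ℝ) :
    (M * N).map Complex.ofReal = M.map Complex.ofReal * N.map Complex.ofReal :=
  Matrix.map_mul (f := Complex.ofRealHom)

theorem cx_injective {ι : Type*} : Function.Injective (cx (ι := ι)) := fun v w h => by
  ext i
  exact Complex.ofReal_injective (congrFun h i)

theorem cx_zero {ι : Type*} : cx (0 : ι → ℝ) = 0 := by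
  ext i; simp [cx]

theorem cx_ne_zero {ι : Type*} {v : ι → ℝ} (h : v ≠ 0) : cx v ≠ 0 := fun h0 =>
  h (cx_injective (h0.trans cx_zero.symm))

theorem rank_eq_iff_surjective {K : Type*} [Field K] {m n : ℕ} (M : Matrix (Fin m) (Fin n) K) :
    M.rank = m ↔ Function.Surjective M.mulVecLin := by
  rw [← LinearMap.range_eq_top, Matrix.rank]
  constructor
  · intro h
    apply Submodule.eq_top_of_finrank_eq
    simpa using h
  · intro h
    rw [h]
    simp

/-- A real right inverse remains a right inverse over `ℂ`. -/
theorem surjective_map_ofReal {m n : ℕ} {M : Matrix (Fin m) (Fin n) ℝ}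
    (h : Function.Surjective M.mulVecLin) :
    Function.Surjective (M.map Complex.ofReal).mulVecLin := by
  choose g hg using fun b : Fin m => h (Pi.single b 1)
  have hmul : M * (Matrix.of fun a b => g b a) = 1 := by
    ext a b
    have := congrFun (hg b) a
    simpa [Matrix.mul_apply, Matrix.mulVec, dotProduct, Matrix.one_apply, Pi.single_apply]
      using this
  intro y
  refine ⟨((Matrix.of fun a b => g b a).map Complex.ofReal).mulVec y, ?_⟩
  rw [Matrix.mulVecLin_apply, Matrix.mulVec_mulVec, ← map_ofReal_mul, hmul,
    Matrix.map_one _ Complex.ofReal_zero Complex.ofReal_one, Matrix.one_mulVec]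

theorem exists_smul_of_finrank_ker {K : Type*} [Field K] {m : ℕ}
    {M : Matrix (Fin m) (Fin (m + 1)) K} (h : Function.Surjective M.mulVecLin)
    {k v : Fin (m + 1) → K} (hk0 : k ≠ 0) (hk : M.mulVec k = 0) (hv : M.mulVec v = 0) :
    ∃ c : K, v = c • k := by
  have h1 := LinearMap.finrank_range_add_finrank_ker M.mulVecLin
  have h3 : Module.finrank K (LinearMap.range M.mulVecLin) = m := by
    rw [LinearMap.range_eq_top.2 h]
    simp
  rw [h3, Module.finrank_fin_fun] at h1
  have h2 : Module.finrank K (LinearMap.ker M.mulVecLin) = 1 := by omega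
  obtain ⟨c, hc⟩ := (finrank_eq_one_iff_of_nonzero' (⟨k, hk⟩ : LinearMap.ker M.mulVecLin)
    (by simpa [Subtype.ext_iff] using hk0)).1 h2 ⟨v, hv⟩
  exact ⟨c, (congrArg Subtype.val hc).symm⟩

/-- The source of the cameras on the other curve: each is the left factor of a product whose right
factor has a known kernel. -/
theorem exists_mul_eq_of_ker_le {K : Type*} [Field K] {l m n : Type*} [Fintype l] [Fintype m]
    [Fintype n] [DecidableEq m] [DecidableEq n] (R : Matrix l n K) (W : Matrix m n K)
    (h : ∀ k, W.mulVec k = 0 → R.mulVec k = 0) : ∃ T : Matrix l m K, R = T * W := by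
  have hle : LinearMap.ker W.mulVecLin ≤ LinearMap.ker R.mulVecLin := fun k hk => h k hk
  obtain ⟨g, hg⟩ := LinearMap.exists_extend
    (((LinearMap.ker W.mulVecLin).liftQ R.mulVecLin hle).comp
      W.mulVecLin.quotKerEquivRange.symm.toLinearMap)
  refine ⟨LinearMap.toMatrix' g, ?_⟩
  apply Matrix.toLin'.injective
  rw [Matrix.toLin'_mul, Matrix.toLin'_toMatrix']
  apply LinearMap.ext
  intro v
  have h2 := LinearMap.congr_fun hg ⟨W.mulVecLin v, LinearMap.mem_range_self _ v⟩
  simp only [LinearMap.comp_apply, Submodule.subtype_apply, LinearEquiv.coe_coe] at h2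
  simp only [LinearMap.comp_apply, Matrix.toLin'_apply]
  rw [← Matrix.mulVecLin_apply W, h2]
  have h3 : W.mulVecLin.quotKerEquivRange.symm ⟨W.mulVecLin v, LinearMap.mem_range_self _ v⟩
      = (LinearMap.ker W.mulVecLin).mkQ v := LinearMap.quotKerEquivRange_symm_apply_image _ _ _
  erw [h3]
  simp

/-! ### Cameras -/

theorem Camera.surjective (P : Camera) : Function.Surjective P.mat.mulVecLin :=
  (rank_eq_iff_surjective _).1 P.rank_eq

/-- The camera given by a surjective matrix. -/
def Camera.ofSurjective (M : Matrix (Fin 3) (Fin 4) ℝ) (h : Function.Surjective M.mulVecLin) :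
    Camera :=
  ⟨M, (rank_eq_iff_surjective M).2 h⟩

theorem Camera.toLin_apply (P : Camera) (v : Fin 4 → ℂ) :
    P.toLin v = (P.mat.map Complex.ofReal).mulVec v := rfl

theorem Camera.toLin_cx (P : Camera) (v : Fin 4 → ℝ) : P.toLin (cx v) = cx (P.mat.mulVec v) := by
  rw [cx_mulVec, Camera.toLin_apply]

theorem Camera.exists_smul (P : Camera) {k v : Fin 4 → ℂ} (hk0 : k ≠ 0) (hk : P.toLin k = 0)
    (hv : P.toLin v = 0) : ∃ c : ℂ, v = c • k :=
  exists_smul_of_finrank_ker (surjective_map_ofReal P.surjective) hk0 hk hv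

theorem Camera.exists_real_ker (P : Camera) : ∃ p : Fin 4 → ℝ, p ≠ 0 ∧ P.mat.mulVec p = 0 := by
  have h : P.mat.mulVecLin.ker ≠ ⊥ := LinearMap.ker_ne_bot_of_finrank_lt (by simp)
  obtain ⟨v, hv, h0⟩ := Submodule.exists_mem_ne_zero_of_ne_bot h
  exact ⟨v, h0, hv⟩

theorem Camera.center_eq_mk_iff (P : Camera) {v : Fin 4 → ℂ} (hv : v ≠ 0) :
    P.center = Projectivization.mk ℂ v hv ↔ P.toLin v = 0 := by
  rw [eq_comm, ← P.toLin_eq_zero_iff]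
  obtain ⟨a, ha⟩ := Projectivization.exists_smul_eq_mk_rep ℂ v hv
  rw [← ha, Units.smul_def, map_smul, smul_eq_zero]
  simp

theorem Camera.center_ne_of {P Q : Camera} {p q : Fin 4 → ℂ} (hp : p ≠ 0) (hP : P.toLin p = 0)
    (hq : q ≠ 0) (hQ : Q.toLin q = 0) (h : ∀ c : ℂ, p ≠ c • q) : P.center ≠ Q.center := by
  rw [(P.center_eq_mk_iff hp).2 hP, (Q.center_eq_mk_iff hq).2 hQ, Ne,
    Projectivization.mk_eq_mk_iff']
  rintro ⟨c, hc⟩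
  exact h c hc.symm

theorem Camera.center_eq_of {P Q : Camera} {p : Fin 4 → ℂ} (hp : p ≠ 0) (hP : P.toLin p = 0)
    (hQ : Q.toLin p = 0) : P.center = Q.center := by
  rw [(P.center_eq_mk_iff hp).2 hP, (Q.center_eq_mk_iff hp).2 hQ]

theorem Camera.sees_mk_iff (P : Camera) {v : Fin 4 → ℂ} (hv : v ≠ 0) (u : P2) :
    P.Sees (Projectivization.mk ℂ v hv) u ↔ P.toLin v ∈ u.submodule := by
  obtain ⟨a, ha⟩ := Projectivization.exists_smul_eq_mk_rep ℂ v hv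
  rw [Camera.Sees, ← ha, Units.smul_def, map_smul]
  exact u.submodule.smul_mem_iff a.ne_zero

/-- The case `m = 0` is that of a camera center, for which every image point is admissible. -/
theorem exists_mem_submodule (m : Fin 3 → ℂ) : ∃ u : P2, m ∈ u.submodule := by
  by_cases h : m = 0
  · exact ⟨Projectivization.mk ℂ (Pi.single 0 1) (by simp), by simp [h]⟩
  · exact ⟨Projectivization.mk ℂ m h, by simp⟩

/-! ### Fundamental forms -/

/-- A kernel vector of the 6 × 6 matrix is `(v, -a, -b)`. This coordinate-free form of the epipolar
relation includes centers (`a = 0` or `b = 0`) and is visibly preserved by projective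
transformations, including complex ones. -/
theorem fundamentalForm_eq_zero_iff (P Q : Camera) (x y : Fin 3 → ℝ) :
    fundamentalForm P Q x y = 0 ↔ ∃ (v : Fin 4 → ℂ) (a b : ℂ), ¬ (v = 0 ∧ a = 0 ∧ b = 0) ∧
      P.toLin v = a • cx x ∧ Q.toLin v = b • cx y := by
  rw [← Complex.ofReal_eq_zero, fundamentalForm, ← Complex.ofRealHom_eq_coe, RingHom.map_det,
    ← Matrix.exists_mulVec_eq_zero_iff]
  constructor
  · rintro ⟨t, ht, h⟩
    refine ⟨![t 0, t 1, t 2, t 3], -t 4, -t 5, ?_, ?_, ?_⟩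
    · rintro ⟨h1, h2, h3⟩
      apply ht
      ext i
      have e0 := congrFun h1 0
      have e1 := congrFun h1 1
      have e2 := congrFun h1 2
      have e3 := congrFun h1 3
      simp at e0 e1 e2 e3 h2 h3
      fin_cases i <;> simpa
    · ext i
      have e0 := congrFun h 0
      have e1 := congrFun h 1
      have e2 := congrFun h 2
      simp [Matrix.mulVec, dotProduct, Fin.sum_univ_succ] at e0 e1 e2
      fin_cases i <;>
        simp [Camera.toLin_apply, Matrix.mulVec, dotProduct, Fin.sum_univ_succ, cx]
      · linear_combination e0
      · linear_combination e1
      · linear_combination e2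
    · ext i
      have e0 := congrFun h 3
      have e1 := congrFun h 4
      have e2 := congrFun h 5
      simp [Matrix.mulVec, dotProduct, Fin.sum_univ_succ] at e0 e1 e2
      fin_cases i <;>
        simp [Camera.toLin_apply, Matrix.mulVec, dotProduct, Fin.sum_univ_succ, cx]
      · linear_combination e0
      · linear_combination e1
      · linear_combination e2
  · rintro ⟨v, a, b, h0, h1, h2⟩
    refine ⟨![v 0, v 1, v 2, v 3, -a, -b], ?_, ?_⟩
    · intro h
      apply h0
      have e0 := congrFun h 0
      have e1 := congrFun h 1
      have e2 := congrFun h 2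
      have e3 := congrFun h 3
      have e4 := congrFun h 4
      have e5 := congrFun h 5
      simp at e0 e1 e2 e3 e4 e5
      refine ⟨?_, e4, e5⟩
      ext i
      fin_cases i <;> simpa
    · have e0 := congrFun h1 0
      have e1 := congrFun h1 1
      have e2 := congrFun h1 2
      have f0 := congrFun h2 0
      have f1 := congrFun h2 1
      have f2 := congrFun h2 2
      simp [Camera.toLin_apply, Matrix.mulVec, dotProduct, Fin.sum_univ_succ, cx]
        at e0 e1 e2 f0 f1 f2
      ext i
      fin_cases i <;> simp [Matrix.mulVec, dotProduct, Fin.sum_univ_succ]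
      · linear_combination e0
      · linear_combination e1
      · linear_combination e2
      · linear_combination f0
      · linear_combination f1
      · linear_combination f2

theorem fundamentalForm_eq_zero_swap (P Q : Camera) (x y : Fin 3 → ℝ) :
    fundamentalForm P Q x y = 0 ↔ fundamentalForm Q P y x = 0 := by
  rw [fundamentalForm_eq_zero_iff, fundamentalForm_eq_zero_iff]
  constructor <;>
  · rintro ⟨v, a, b, h0, h1, h2⟩
    exact ⟨v, b, a, fun h => h0 ⟨h.1, h.2.2, h.2.1⟩, h2, h1⟩

/-- The coordinate extension `x ↦ (x, 0)` from `ℝ³` to `ℝ⁶`. -/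
def extendLeft : (Fin 3 → ℝ) →ₗ[ℝ] (Fin 6 → ℝ) :=
  (Matrix.of fun (i : Fin 6) (j : Fin 3) => if (i : ℕ) = j then (1 : ℝ) else 0).mulVecLin

/-- The coordinate extension `y ↦ (0, y)` from `ℝ³` to `ℝ⁶`. -/
def extendRight : (Fin 3 → ℝ) →ₗ[ℝ] (Fin 6 → ℝ) :=
  (Matrix.of fun (i : Fin 6) (j : Fin 3) => if (i : ℕ) = j + 3 then (1 : ℝ) else 0).mulVecLin

/-- Replacing one column of a fixed matrix is a component of its Cramer map, hence linear in the new
column; the zero column only holds the place of `x`. -/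
theorem fundamentalForm_linear_left (P Q : Camera) (y : Fin 3 → ℝ) :
    ∃ f : (Fin 3 → ℝ) →ₗ[ℝ] ℝ, ∀ x, fundamentalForm P Q x y = f x := by
  refine ⟨(LinearMap.proj (4 : Fin 6)).comp ((Matrix.cramer
    !![P.mat 0 0, P.mat 0 1, P.mat 0 2, P.mat 0 3, 0, 0;
       P.mat 1 0, P.mat 1 1, P.mat 1 2, P.mat 1 3, 0, 0;
       P.mat 2 0, P.mat 2 1, P.mat 2 2, P.mat 2 3, 0, 0;
       Q.mat 0 0, Q.mat 0 1, Q.mat 0 2, Q.mat 0 3, 0, y 0;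
       Q.mat 1 0, Q.mat 1 1, Q.mat 1 2, Q.mat 1 3, 0, y 1;
       Q.mat 2 0, Q.mat 2 1, Q.mat 2 2, Q.mat 2 3, 0, y 2]).comp extendLeft), fun x => ?_⟩
  rw [LinearMap.comp_apply, LinearMap.comp_apply, LinearMap.proj_apply, Matrix.cramer_apply, fundamentalForm]
  congr 1
  ext i j
  fin_cases i <;> fin_cases j <;>
    simp [extendLeft, Matrix.mulVec, dotProduct, Fin.sum_univ_succ]

theorem fundamentalForm_linear_right (P Q : Camera) (x : Fin 3 → ℝ) :
    ∃ f : (Fin 3 → ℝ) →ₗ[ℝ] ℝ, ∀ y, fundamentalForm P Q x y = f y := by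
  refine ⟨(LinearMap.proj (5 : Fin 6)).comp ((Matrix.cramer
    !![P.mat 0 0, P.mat 0 1, P.mat 0 2, P.mat 0 3, x 0, 0;
       P.mat 1 0, P.mat 1 1, P.mat 1 2, P.mat 1 3, x 1, 0;
       P.mat 2 0, P.mat 2 1, P.mat 2 2, P.mat 2 3, x 2, 0;
       Q.mat 0 0, Q.mat 0 1, Q.mat 0 2, Q.mat 0 3, 0, 0;
       Q.mat 1 0, Q.mat 1 1, Q.mat 1 2, Q.mat 1 3, 0, 0;
       Q.mat 2 0, Q.mat 2 1, Q.mat 2 2, Q.mat 2 3, 0, 0]).comp extendRight), fun y => ?_⟩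
  rw [LinearMap.comp_apply, LinearMap.comp_apply, LinearMap.proj_apply, Matrix.cramer_apply, fundamentalForm]
  congr 1
  ext i j
  fin_cases i <;> fin_cases j <;>
    simp [extendRight, Matrix.mulVec, dotProduct, Fin.sum_univ_succ]

theorem fundamentalForm_eq_sum (P Q : Camera) (x y : Fin 3 → ℝ) :
    fundamentalForm P Q x y = ∑ a, ∑ b, x a * (y b * fundamentalMatrix P Q a b) := by
  have h1 : ∀ x y, fundamentalForm P Q x y
      = ∑ a, x a * fundamentalForm P Q (Pi.single a 1) y := fun x y => by
    obtain ⟨f, hf⟩ := fundamentalForm_linear_left P Q y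
    simp only [hf]
    rw [LinearMap.pi_apply_eq_sum_univ f x]
    refine Finset.sum_congr rfl fun a _ => ?_
    rw [smul_eq_mul]
    congr 2
    ext b
    simp [Pi.single_apply, eq_comm]
  have h2 : ∀ x y, fundamentalForm P Q x y
      = ∑ b, y b * fundamentalForm P Q x (Pi.single b 1) := fun x y => by
    obtain ⟨f, hf⟩ := fundamentalForm_linear_right P Q x
    simp only [hf]
    rw [LinearMap.pi_apply_eq_sum_univ f y]
    refine Finset.sum_congr rfl fun a _ => ?_
    rw [smul_eq_mul]
    congr 2
    ext b
    simp [Pi.single_apply, eq_comm]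
  rw [h1]
  refine Finset.sum_congr rfl fun a _ => ?_
  rw [h2, Finset.mul_sum]
  rfl

/-! ### Separating camera pairs by epipolar pairs -/

/-- Some pair of image points is epipolar for exactly one of the two pairs of cameras. -/
def Distinguishable (P₁ P₂ Q₁ Q₂ : Camera) : Prop :=
  ∃ x y, ¬ (fundamentalForm P₁ P₂ x y = 0 ↔ fundamentalForm Q₁ Q₂ x y = 0)

theorem Distinguishable.symm {P₁ P₂ Q₁ Q₂ : Camera} (h : Distinguishable P₁ P₂ Q₁ Q₂) :
    Distinguishable Q₁ Q₂ P₁ P₂ := by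
  obtain ⟨x, y, h⟩ := h
  exact ⟨x, y, fun h' => h h'.symm⟩

theorem Distinguishable.swap {P₁ P₂ Q₁ Q₂ : Camera} (h : Distinguishable P₁ P₂ Q₁ Q₂) :
    Distinguishable P₂ P₁ Q₂ Q₁ := by
  obtain ⟨x, y, h⟩ := h
  refine ⟨y, x, fun h' => h ?_⟩
  rw [fundamentalForm_eq_zero_swap, h', fundamentalForm_eq_zero_swap]

theorem Distinguishable.fundamentalMatrix_ne {P₁ P₂ Q₁ Q₂ : Camera}
    (h : Distinguishable P₁ P₂ Q₁ Q₂) :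
    ¬ ∃ c : ℝ, c ≠ 0 ∧ fundamentalMatrix Q₁ Q₂ = c • fundamentalMatrix P₁ P₂ := by
  rintro ⟨c, hc, hF⟩
  obtain ⟨x, y, h⟩ := h
  apply h
  have : fundamentalForm Q₁ Q₂ x y = c * fundamentalForm P₁ P₂ x y := by
    simp only [fundamentalForm_eq_sum, hF, Finset.mul_sum, Matrix.smul_apply, smul_eq_mul]
    refine Finset.sum_congr rfl fun a _ => Finset.sum_congr rfl fun b _ => ?_
    ring
  rw [this]
  simp [hc]

/-- If the image under `P₂` of the center of `P₁` is the image under `Q₂` of a point off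
the base line of `Q₁` and `Q₂`, then the pairs are distinguishable. -/
theorem distinguishable_of_epipole {P₁ P₂ Q₁ Q₂ : Camera} {c u k₁ k₂ : Fin 4 → ℂ}
    {y : Fin 3 → ℝ} {s : ℂ} (hc0 : c ≠ 0) (hc : P₁.toLin c = 0) (hcy : P₂.toLin c = s • cx y)
    (hu : Q₂.toLin u = cx y) (h₁ : Q₁.toLin k₁ = 0) (h₂ : Q₂.toLin k₂ = 0)
    (hind : ∀ a b d : ℂ, a • u + b • k₁ + d • k₂ = 0 → a = 0 ∧ b = 0 ∧ d = 0) :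
    Distinguishable P₁ P₂ Q₁ Q₂ := by
  have hk₁ : k₁ ≠ 0 := fun h => by simpa using hind 0 1 0 (by simp [h])
  have hk₂ : k₂ ≠ 0 := fun h => by simpa using hind 0 0 1 (by simp [h])
  -- An image point off the epipolar line of `u` in the first view. It can be taken real because
  -- real vectors span `ℂ³`, so they do not all lie in a plane.
  obtain ⟨x, hx⟩ : ∃ x : Fin 3 → ℝ,
      cx x ∉ Submodule.span ℂ ({Q₁.toLin u, Q₁.toLin k₂} : Set (Fin 3 → ℂ)) := by
    by_contra! hcon
    have htop : Submodule.span ℂ ({Q₁.toLin u, Q₁.toLin k₂} : Set (Fin 3 → ℂ)) = ⊤ := by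
      rw [eq_top_iff]
      intro v _
      rw [← Finset.univ_sum_single v]
      refine Submodule.sum_mem _ fun i _ => ?_
      have := Submodule.smul_mem _ (v i) (hcon (Pi.single i 1))
      convert this using 1
      ext j
      rcases eq_or_ne i j with rfl | h
      · simp [cx]
      · simp [cx, h.symm]
    have h := finrank_span_le_card (R := ℂ) ({Q₁.toLin u, Q₁.toLin k₂} : Set (Fin 3 → ℂ))
    rw [htop, finrank_top, Module.finrank_fin_fun] at h
    have h' : ({Q₁.toLin u, Q₁.toLin k₂} : Set (Fin 3 → ℂ)).toFinset.card ≤ 2 := by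
      rw [Set.toFinset_insert, Set.toFinset_singleton]
      exact Finset.card_le_two
    omega
  refine ⟨x, y, fun hiff => ?_⟩
  -- The center of `P₁` projects to zero in the first view, so `y` is its partner for every `x`.
  have hP : fundamentalForm P₁ P₂ x y = 0 :=
    (fundamentalForm_eq_zero_iff _ _ _ _).2 ⟨c, 0, s, fun h => hc0 h.1, by simpa using hc, hcy⟩
  obtain ⟨v, a, b, h0, hv₁, hv₂⟩ := (fundamentalForm_eq_zero_iff _ _ _ _).1 (hiff.1 hP)
  -- A space point seen at `y` by `Q₂` lies on the line of `u` and the center of `Q₂`. By the choice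
  -- of `x` it must then be the center of `Q₁`, against the independence `hind`.
  obtain ⟨t, ht⟩ := Q₂.exists_smul hk₂ h₂ (v := v - b • u) (by simp [hv₂, hu])
  have hv : v = b • u + t • k₂ := by rw [← ht]; abel
  have ha : a = 0 := by
    by_contra ha
    apply hx
    have : cx x = (a⁻¹ * b) • Q₁.toLin u + (a⁻¹ * t) • Q₁.toLin k₂ := by
      rw [mul_smul, mul_smul, ← smul_add, ← map_smul, ← map_smul Q₁.toLin t, ← map_add, ← hv, hv₁,
        smul_smul, inv_mul_cancel₀ ha, one_smul]
    rw [this]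
    exact add_mem (Submodule.smul_mem _ _ (Submodule.subset_span (by simp)))
      (Submodule.smul_mem _ _ (Submodule.subset_span (by simp)))
  rw [ha, zero_smul] at hv₁
  obtain ⟨r, hr⟩ := Q₁.exists_smul hk₁ h₁ hv₁
  obtain ⟨e1, e2, e3⟩ := hind b (-r) t (by rw [neg_smul, ← hr, hv]; abel)
  apply h0
  simp [hv, ha, e1, e3]

/-! ### Conjugate configurations from parametrizations -/

/-- An equivalence transports witnesses of the epipolar relation, merely rescaling the image
factors; the point sets play no role. -/
theorem not_equivalent_of_distinguishable {n : ℕ} {P Q : CameraTuple n} {i j : Fin n}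
    (h : Distinguishable (P.cam i) (P.cam j) (Q.cam i) (Q.cam j)) (X Y : Set P3) :
    ¬ Equivalent P X Q Y := by
  rintro ⟨H, -, hH⟩
  obtain ⟨x, y, h⟩ := h
  obtain ⟨c, hc, hci⟩ := hH i
  obtain ⟨d, hd, hdj⟩ := hH j
  apply h
  rw [fundamentalForm_eq_zero_iff, fundamentalForm_eq_zero_iff]
  constructor
  · rintro ⟨v, a, b, h0, h1, h2⟩
    refine ⟨H v, c⁻¹ * a, d⁻¹ * b, ?_, ?_, ?_⟩
    · simpa [hc, hd] using h0
    · rw [mul_smul, ← h1, hci, smul_smul, inv_mul_cancel₀ hc, one_smul]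
    · rw [mul_smul, ← h2, hdj, smul_smul, inv_mul_cancel₀ hd, one_smul]
  · rintro ⟨v, a, b, h0, h1, h2⟩
    refine ⟨H.symm v, c * a, d * b, ?_, ?_, ?_⟩
    · simpa [hc, hd] using h0
    · rw [hci, H.apply_symm_apply, h1, smul_smul]
    · rw [hdj, H.apply_symm_apply, h2, smul_smul]

/-- Two parametrized families of space points have proportional images under `P` and `Q`. -/
def HaveCommonImages {n : ℕ} {ι : Type*} (P Q : CameraTuple n) (f g : ι → Fin 4 → ℂ) : Prop :=
  ∀ i z, ∃ (m : Fin 3 → ℂ) (c d : ℂ),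
    (P.cam i).toLin (f z) = c • m ∧ (Q.cam i).toLin (g z) = d • m

theorem HaveCommonImages.symm {n : ℕ} {ι : Type*} {P Q : CameraTuple n} {f g : ι → Fin 4 → ℂ}
    (h : HaveCommonImages P Q f g) : HaveCommonImages Q P g f := fun i z => by
  obtain ⟨m, c, d, h1, h2⟩ := h i z
  exact ⟨m, d, c, h2, h1⟩

theorem HaveCommonImages.exists_reconstruction {n : ℕ} {ι : Type*} {P Q : CameraTuple n}
    {f g : ι → Fin 4 → ℂ} (h : HaveCommonImages P Q f g) (hf : ∀ z, f z ≠ 0) (hg : ∀ z, g z ≠ 0)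
    (Z : Set ι) : ∃ S, IsReconstruction P ((fun z => Projectivization.mk ℂ (f z) (hf z)) '' Z) S ∧
      IsReconstruction Q ((fun z => Projectivization.mk ℂ (g z) (hg z)) '' Z) S := by
  choose m c d hc hd using h
  -- The common set of image tuples. Where `m i z` vanishes the entry is unconstrained, as it should
  -- be at a center; a vanishing scalar `c` or `d` with `m i z` nonzero selects one of the images
  -- allowed to a center.
  refine ⟨{s | ∃ z ∈ Z, ∀ i, m i z ∈ (s i).submodule}, ⟨?_, ?_⟩, ⟨?_, ?_⟩⟩
  · rintro s ⟨z, hz, hs⟩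
    refine ⟨_, ⟨z, hz, rfl⟩, fun i => ?_⟩
    rw [Camera.sees_mk_iff, hc]
    exact Submodule.smul_mem _ _ (hs i)
  · rintro _ ⟨z, hz, rfl⟩
    choose s hs using fun i => exists_mem_submodule (m i z)
    refine ⟨s, ⟨z, hz, hs⟩, fun i => ?_⟩
    rw [Camera.sees_mk_iff, hc]
    exact Submodule.smul_mem _ _ (hs i)
  · rintro s ⟨z, hz, hs⟩
    refine ⟨_, ⟨z, hz, rfl⟩, fun i => ?_⟩
    rw [Camera.sees_mk_iff, hd]
    exact Submodule.smul_mem _ _ (hs i)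
  · rintro _ ⟨z, hz, rfl⟩
    choose s hs using fun i => exists_mem_submodule (m i z)
    refine ⟨s, ⟨z, hz, hs⟩, fun i => ?_⟩
    rw [Camera.sees_mk_iff, hd]
    exact Submodule.smul_mem _ _ (hs i)

theorem HaveCommonImages.exists_conjugate {n : ℕ} {ι : Type*} {P Q : CameraTuple n}
    {f g : ι → Fin 4 → ℂ} (h : HaveCommonImages P Q f g) (hf : ∀ z, f z ≠ 0) (hg : ∀ z, g z ≠ 0)
    {i j : Fin n} (hD : Distinguishable (P.cam i) (P.cam j) (Q.cam i) (Q.cam j)) (X : Set P3)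
    (hX : X ⊆ Set.range fun z => Projectivization.mk ℂ (f z) (hf z)) :
    Conjugate P X Q ((fun z => Projectivization.mk ℂ (g z) (hg z)) ''
      ((fun z => Projectivization.mk ℂ (f z) (hf z)) ⁻¹' X)) := by
  refine ⟨?_, not_equivalent_of_distinguishable hD _ _⟩
  have := h.exists_reconstruction hf hg ((fun z => Projectivization.mk ℂ (f z) (hf z)) ⁻¹' X)
  rwa [Set.image_preimage_eq_of_subset hX] at this

theorem HaveCommonImages.conjugateAlong {n : ℕ} (hn : 2 ≤ n) {ι : Type*} {P Q : CameraTuple n}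
    {f g : ι → Fin 4 → ℂ} (h : HaveCommonImages P Q f g) (hf : ∀ z, f z ≠ 0) (hg : ∀ z, g z ≠ 0)
    (hD : ∀ i j, i ≠ j → Distinguishable (P.cam i) (P.cam j) (Q.cam i) (Q.cam j)) :
    ConjugateAlong P (Set.range fun z => Projectivization.mk ℂ (f z) (hf z))
      Q (Set.range fun z => Projectivization.mk ℂ (g z) (hg z)) := by
  have hFd : FundamentalMatricesDiffer P Q := fun i j hij => (hD i j hij).fundamentalMatrix_ne
  have hD0 := hD ⟨0, by omega⟩ ⟨1, by omega⟩ (by simp)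
  refine ⟨⟨?_, hFd⟩, fun X hX => ⟨_, Set.image_subset_range _ _, h.exists_conjugate hf hg hD0 X hX,
    hFd⟩, fun Y hY => ⟨_, Set.image_subset_range _
      ((fun z => Projectivization.mk ℂ (g z) (hg z)) ⁻¹' Y), ⟨?_,
      not_equivalent_of_distinguishable hD0 _ _⟩, hFd⟩⟩
  · have := h.exists_conjugate hf hg hD0 _ subset_rfl
    rwa [Set.preimage_range, Set.image_univ] at this
  · obtain ⟨S, h1, h2⟩ := (h.symm.exists_conjugate hg hf hD0.symm Y hY).1
    exact ⟨S, h2, h1⟩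

theorem ConjugateAlong.isNonTriviallyCritical {n : ℕ} {P Q : CameraTuple n} {C D : Set P3}
    (h : ConjugateAlong P C Q D) {X : Set P3} (hX : X ⊆ C) : IsNonTriviallyCritical P X := by
  obtain ⟨Y, -, hY⟩ := h.2.1 X hX
  exact ⟨Q, Y, hY⟩

/-! ### Binary forms: Veronese vectors and contractions -/

section Contraction

variable {K : Type*} [Field K] {d : ℕ}

/-- The Veronese vector over an arbitrary field; over `ℂ` this is `veronese`. -/
def ver (d : ℕ) (z : Fin 2 → K) : Fin (d + 1) → K :=
  fun k => z 0 ^ (k : ℕ) * z 1 ^ (d - (k : ℕ))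

/-- The linear form vanishing at `w`, evaluated at `z`. -/
def lin (w z : Fin 2 → K) : K := w 1 * z 0 - w 0 * z 1

/-- The matrix contracting the dual of forms of degree `d + 1` with the linear form `lin w`. -/
def shift (d : ℕ) (w : Fin 2 → K) : Matrix (Fin (d + 1)) (Fin (d + 2)) K :=
  Matrix.of fun i j => (if i.succ = j then w 1 else 0) - (if i.castSucc = j then w 0 else 0)

/-- Contraction with the linear form `lin w`. -/
def con (w : Fin 2 → K) (v : Fin (d + 2) → K) : Fin (d + 1) → K :=
  fun i => w 1 * v i.succ - w 0 * v i.castSucc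

theorem shift_mulVec (w : Fin 2 → K) (v : Fin (d + 2) → K) :
    (shift d w).mulVec v = con w v := by
  ext i
  simp [shift, con, Matrix.mulVec, dotProduct, sub_mul, Finset.sum_sub_distrib]

/-- The identity on which the passage between quartic, cubic and conic rests: contracting at `w` is
projecting the rational normal curve from its point at `w`. -/
theorem con_ver (w z : Fin 2 → K) : con w (ver (d + 1) z) = lin w z • ver d z := by
  ext i
  have h : d + 1 - (i : ℕ) = d - i + 1 := by omega
  simp only [con, ver, lin, Fin.val_succ, Fin.val_castSucc, Pi.smul_apply, smul_eq_mul, h,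
    Nat.add_sub_add_right]
  ring

theorem con_add (w : Fin 2 → K) (u v : Fin (d + 2) → K) : con w (u + v) = con w u + con w v := by
  ext i; simp [con]; ring

theorem con_sub (w : Fin 2 → K) (u v : Fin (d + 2) → K) : con w (u - v) = con w u - con w v := by
  ext i; simp [con]; ring

theorem con_smul (w : Fin 2 → K) (c : K) (v : Fin (d + 2) → K) : con w (c • v) = c • con w v := by
  ext i; simp [con]; ring

theorem con_zero (w : Fin 2 → K) : con w (0 : Fin (d + 2) → K) = 0 := by
  ext i; simp [con]

theorem add_con (w x : Fin 2 → K) (v : Fin (d + 2) → K) : con (w + x) v = con w v + con x v := by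
  ext i; simp [con]; ring

theorem sub_con (w x : Fin 2 → K) (v : Fin (d + 2) → K) : con (w - x) v = con w v - con x v := by
  ext i; simp [con]; ring

theorem smul_con (w : Fin 2 → K) (c : K) (v : Fin (d + 2) → K) : con (c • w) v = c • con w v := by
  ext i; simp [con]; ring

theorem zero_con (v : Fin (d + 2) → K) : con 0 v = 0 := by
  ext i; simp [con]

theorem con_comm (w x : Fin 2 → K) (v : Fin (d + 3) → K) : con w (con x v) = con x (con w v) := by
  ext i
  simp only [con, Fin.succ_castSucc]
  ring

theorem lin_self (w : Fin 2 → K) : lin w w = 0 := by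
  simp only [lin]; ring

theorem lin_swap (w z : Fin 2 → K) : lin z w = - lin w z := by
  simp only [lin]; ring

theorem lin_ne_zero_swap {w z : Fin 2 → K} (h : lin w z ≠ 0) : lin z w ≠ 0 := by
  rw [lin_swap]; simpa using h

theorem lin_smul (w z : Fin 2 → K) (c : K) : lin w (c • z) = c * lin w z := by
  simp [lin]; ring

theorem lin_add (w z y : Fin 2 → K) : lin w (z + y) = lin w z + lin w y := by
  simp [lin]; ring

theorem lin_sub (w z y : Fin 2 → K) : lin w (z - y) = lin w z - lin w y := by
  simp [lin]; ring

theorem smul_lin (w z : Fin 2 → K) (c : K) : lin (c • w) z = c * lin w z := by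
  simp [lin]; ring

theorem exists_smul_of_lin_eq_zero {w z : Fin 2 → K} (hz : z ≠ 0) (h : lin w z = 0) :
    ∃ c : K, w = c • z := by
  simp only [lin, sub_eq_zero] at h
  by_cases h0 : z 0 = 0
  · have h1 : z 1 ≠ 0 := fun h1 => hz (by ext i; fin_cases i <;> simpa)
    refine ⟨w 1 / z 1, ?_⟩
    have : w 0 = 0 := by simpa [h0, h1] using h.symm
    ext i
    fin_cases i
    · simp [this, h0]
    · simp [h1]
  · refine ⟨w 0 / z 0, ?_⟩
    ext i
    fin_cases i
    · simp [h0]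
    · simp only [Fin.mk_one, Pi.smul_apply, smul_eq_mul]
      field_simp
      linear_combination h

theorem exists_lin_ne_zero {z : Fin 2 → K} (hz : z ≠ 0) : ∃ w : Fin 2 → K, w ≠ 0 ∧ lin z w ≠ 0 := by
  by_cases h0 : z 0 = 0
  · have h1 : z 1 ≠ 0 := fun h1 => hz (by ext i; fin_cases i <;> simpa)
    exact ⟨![1, 0], by simp, by simpa [lin]⟩
  · exact ⟨![0, 1], by simp, by simpa [lin]⟩

theorem ne_zero_of_lin_left {w z : Fin 2 → K} (h : lin w z ≠ 0) : w ≠ 0 := by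
  rintro rfl; simp [lin] at h

theorem ne_zero_of_lin_right {w z : Fin 2 → K} (h : lin w z ≠ 0) : z ≠ 0 := by
  rintro rfl; simp [lin] at h

theorem ver_ne_zero {z : Fin 2 → K} (hz : z ≠ 0) : ver d z ≠ 0 := by
  intro h
  apply hz
  have h0 := congrFun h 0
  have h1 := congrFun h (Fin.last d)
  simp [ver] at h0 h1
  ext i
  fin_cases i
  · exact h1.1
  · exact h0.1

theorem ver_smul (c : K) (z : Fin 2 → K) : ver d (c • z) = c ^ d • ver d z := by
  ext k
  have h : c ^ d = c ^ (k : ℕ) * c ^ (d - (k : ℕ)) := by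
    rw [← pow_add]; congr 1; omega
  simp only [ver, Pi.smul_apply, smul_eq_mul, h]
  ring

/-- The condition is the recursion `w 1 * v (i+1) = w 0 * v i`, so `v` is a geometric progression;
for `w 1 = 0` only its last entry survives. -/
theorem eq_smul_ver_of_con_eq_zero {w : Fin 2 → K} (hw : w ≠ 0) {v : Fin (d + 2) → K}
    (h : con w v = 0) : ∃ a : K, v = a • ver (d + 1) w := by
  have hi : ∀ i : Fin (d + 1), w 1 * v i.succ = w 0 * v i.castSucc := fun i =>
    sub_eq_zero.1 (congrFun h i)
  by_cases h1 : w 1 = 0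
  · have h0 : w 0 ≠ 0 := fun h0 => hw (by ext i; fin_cases i <;> simpa)
    have hv : ∀ i : Fin (d + 1), v i.castSucc = 0 := fun i => by
      have := hi i
      simpa [h1, h0] using this.symm
    refine ⟨v (Fin.last _) / w 0 ^ (d + 1), ?_⟩
    ext i
    refine Fin.lastCases ?_ (fun j => ?_) i
    · simp [ver, h0]
    · have : d + 1 - (j : ℕ) ≠ 0 := by omega
      simp [hv, ver, h1, this]
  · refine ⟨v 0 / w 1 ^ (d + 1), ?_⟩
    ext i
    induction i using Fin.induction with
    | zero => simp [ver, h1]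
    | succ j ih =>
      apply mul_left_cancel₀ h1
      rw [hi, ih]
      have : d + 1 - (j : ℕ) = d - j + 1 := by omega
      simp only [ver, Pi.smul_apply, smul_eq_mul, Fin.val_succ, Fin.val_castSucc, this,
        Nat.add_sub_add_right]
      ring

theorem shift_surjective {w : Fin 2 → K} (hw : w ≠ 0) :
    Function.Surjective (shift d w).mulVecLin := by
  rw [← LinearMap.range_eq_top]
  apply Submodule.eq_top_of_finrank_eq
  have h1 := LinearMap.finrank_range_add_finrank_ker (shift d w).mulVecLin
  have h2 : LinearMap.ker (shift d w).mulVecLin ≤ Submodule.span K {ver (d + 1) w} := by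
    intro v hv
    rw [LinearMap.mem_ker, Matrix.mulVecLin_apply, shift_mulVec] at hv
    obtain ⟨a, ha⟩ := eq_smul_ver_of_con_eq_zero hw hv
    exact Submodule.mem_span_singleton.2 ⟨a, ha.symm⟩
  have h3 := (Submodule.finrank_mono h2).trans (finrank_span_singleton (ver_ne_zero hw)).le
  have h4 := LinearMap.finrank_range_le (shift d w).mulVecLin
  have h5 := (LinearMap.range (shift d w).mulVecLin).finrank_le
  simp only [Module.finrank_fin_fun] at h1 h4 h5 ⊢
  omega

/-- Veronese vectors of two distinct points are linearly independent in positive degree. -/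
theorem eq_zero_of_smul_ver_add {z w : Fin 2 → K} (h : lin z w ≠ 0) {a b : K}
    (hab : a • ver (d + 1) z + b • ver (d + 1) w = 0) : a = 0 ∧ b = 0 := by
  have h1 := congrArg (con z) hab
  have h2 := congrArg (con w) hab
  simp only [con_add, con_smul, con_ver, con_zero, lin_self, zero_smul, smul_zero, zero_add,
    add_zero, smul_smul, smul_eq_zero, mul_eq_zero, ver_ne_zero (ne_zero_of_lin_left h),
    ver_ne_zero (ne_zero_of_lin_right h), h, lin_ne_zero_swap h, or_false] at h1 h2
  exact ⟨h2, h1⟩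

/-- Contraction at `z` removes the first term and leaves two Veronese vectors of lower degree. -/
theorem eq_zero_of_smul_ver_add_add {z w y : Fin 2 → K} (h : lin z w ≠ 0) (h' : lin z y ≠ 0)
    (h'' : lin w y ≠ 0) {a b c : K}
    (hab : a • ver (d + 2) z + b • ver (d + 2) w + c • ver (d + 2) y = 0) :
    a = 0 ∧ b = 0 ∧ c = 0 := by
  have h1 := congrArg (con z) hab
  simp only [con_add, con_smul, con_ver, con_zero, lin_self, zero_smul, smul_zero, zero_add,
    smul_smul] at h1
  obtain ⟨e1, e2⟩ := eq_zero_of_smul_ver_add h'' h1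
  have hb : b = 0 := by simpa [h] using e1
  have hc : c = 0 := by simpa [h'] using e2
  subst hb hc
  simpa [ver_ne_zero (ne_zero_of_lin_left h)] using hab

/-- A dual quartic whose contraction at `w` is a Veronese vector. -/
theorem exists_eq_ver_add {z w : Fin 2 → K} (h : lin w z ≠ 0) {a : K} {k : Fin (d + 2) → K}
    (hk : con w k = a • ver d z) :
    ∃ α β : K, k = α • ver (d + 1) z + β • ver (d + 1) w := by
  have : con w (k - (a / lin w z) • ver (d + 1) z) = 0 := by
    rw [con_sub, con_smul, con_ver, hk, smul_smul, div_mul_cancel₀ _ h, sub_self]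
  obtain ⟨β, hβ⟩ := eq_smul_ver_of_con_eq_zero (ne_zero_of_lin_left h) this
  exact ⟨_, β, by rw [← hβ]; abel⟩

/-- If two points of the line of contractions of `k` are distinct Veronese points, then `k` is
on the line spanned by the Veronese points of degree one more. -/
theorem eq_ver_add_of_con_of_con {x y z w : Fin 2 → K} {k : Fin (d + 4) → K} {a b : K}
    (hzw : lin z w ≠ 0) (ha : a ≠ 0) (hb : b ≠ 0) (hx : con x k = a • ver (d + 2) z)
    (hy : con y k = b • ver (d + 2) w) :
    lin x w = 0 ∧ lin y z = 0 ∧ ∃ α β : K, k = α • ver (d + 3) z + β • ver (d + 3) w := by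
  have hz0 := ne_zero_of_lin_left hzw
  have hw0 := ne_zero_of_lin_right hzw
  -- Contracting `k` at `x` and `y` in either order gives a multiple of the Veronese vector of `z`
  -- and one of that of `w`. These are independent, so both multiples vanish.
  have h := con_comm y x k
  rw [hx, hy, con_smul, con_smul, con_ver, con_ver, smul_smul, smul_smul, ← sub_eq_zero,
    sub_eq_add_neg, ← neg_smul] at h
  obtain ⟨e1, e2⟩ := eq_zero_of_smul_ver_add hzw h
  have hyz : lin y z = 0 := by simpa [ha] using e1
  have hxw : lin x w = 0 := by simpa [hb] using e2
  refine ⟨hxw, hyz, ?_⟩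
  obtain ⟨c, rfl⟩ := exists_smul_of_lin_eq_zero hz0 hyz
  have hc : c ≠ 0 := by
    rintro rfl
    rw [zero_smul, zero_con, eq_comm, smul_eq_zero] at hy
    exact hy.elim hb (ver_ne_zero hw0)
  have : con z k = (c⁻¹ * b) • ver (d + 2) w := by
    rw [mul_smul, ← hy, smul_con, smul_smul, inv_mul_cancel₀ hc, one_smul]
  obtain ⟨α, β, h⟩ := exists_eq_ver_add hzw this
  exact ⟨β, α, by rw [h]; abel⟩

/-! ### Derivatives of Veronese vectors -/

/-- The derivative of the Veronese map at `z` in direction `h`. -/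
def dver (d : ℕ) (z h : Fin 2 → K) : Fin (d + 1) → K := fun k =>
  (k : ℕ) * z 0 ^ ((k : ℕ) - 1) * z 1 ^ (d - (k : ℕ)) * h 0 +
    (d - (k : ℕ) : ℕ) * z 0 ^ (k : ℕ) * z 1 ^ (d - (k : ℕ) - 1) * h 1

theorem dver_add (z h g : Fin 2 → K) : dver d z (h + g) = dver d z h + dver d z g := by
  ext k; simp [dver]; ring

theorem dver_smul (z h : Fin 2 → K) (c : K) : dver d z (c • h) = c • dver d z h := by
  ext k; simp [dver]; ring

/-- The Leibniz rule applied to `con_ver`. -/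
theorem con_dver_four (w z h : Fin 2 → K) :
    con w (dver 4 z h) = lin w h • ver 3 z + lin w z • dver 3 z h := by
  ext k
  fin_cases k <;> simp [con, dver, ver, lin, Fin.succ, Fin.castSucc] <;> ring

theorem con_dver_three (w z h : Fin 2 → K) :
    con w (dver 3 z h) = lin w h • ver 2 z + lin w z • dver 2 z h := by
  ext k
  fin_cases k <;> simp [con, dver, ver, lin, Fin.succ, Fin.castSucc] <;> ring

/-- Euler's relation in degree 4. -/
theorem dver_four_self (z : Fin 2 → K) : dver 4 z z = (4 : K) • ver 4 z := by
  ext k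
  fin_cases k <;> simp [dver, ver] <;> ring

theorem dver_three_self (z : Fin 2 → K) : dver 3 z z = (3 : K) • ver 3 z := by
  ext k
  fin_cases k <;> simp [dver, ver] <;> ring

end Contraction

theorem cx_ver (d : ℕ) (z : Fin 2 → ℝ) : cx (ver d z) = ver d (cx z) := by
  ext k; simp [cx, ver]

theorem cx_con {d : ℕ} (w : Fin 2 → ℝ) (k : Fin (d + 2) → ℝ) : cx (con w k) = con (cx w) (cx k) := by
  ext i; simp [cx, con]

theorem shift_map (d : ℕ) (w : Fin 2 → ℝ) : (shift d w).map Complex.ofReal = shift d (cx w) := by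
  ext i j
  simp only [shift, Matrix.map_apply, Matrix.of_apply, cx]
  split_ifs <;> simp

theorem fderiv_paramMap_apply {d : ℕ} (A : Matrix (Fin 4) (Fin (d + 1)) ℝ) (z h : Fin 2 → ℂ) :
    fderiv ℂ (paramMap A) z h = (A.map Complex.ofReal).mulVec (dver d z h) := by
  have hv : HasFDerivAt (veronese d) (ContinuousLinearMap.pi fun k : Fin (d + 1) =>
      ((k : ℕ) * z 0 ^ ((k : ℕ) - 1) * z 1 ^ (d - (k : ℕ))) •
        ContinuousLinearMap.proj (R := ℂ) (φ := fun _ : Fin 2 => ℂ) 0 +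
      ((d - (k : ℕ) : ℕ) * z 0 ^ (k : ℕ) * z 1 ^ (d - (k : ℕ) - 1)) •
        ContinuousLinearMap.proj (R := ℂ) (φ := fun _ : Fin 2 => ℂ) 1) z := by
    rw [hasFDerivAt_pi]
    intro k
    have h0 := (hasFDerivAt_apply (𝕜 := ℂ) (F' := fun _ : Fin 2 => ℂ) 0 z).pow (k : ℕ)
    have h1 := (hasFDerivAt_apply (𝕜 := ℂ) (F' := fun _ : Fin 2 => ℂ) 1 z).pow (d - (k : ℕ))
    refine (h0.mul h1).congr_fderiv ?_
    ext v
    simp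
    ring
  have hA := ((A.map Complex.ofReal).mulVecLin.toContinuousLinearMap).hasFDerivAt.comp z hv
  have : paramMap A = (A.map Complex.ofReal).mulVecLin.toContinuousLinearMap ∘ veronese d := rfl
  rw [this, hA.fderiv]
  simp only [ContinuousLinearMap.comp_apply, LinearMap.coe_toContinuousLinearMap',
    Matrix.mulVecLin_apply]
  congr 1

/-! ### Lines, curves and dual quartics -/

theorem paramMap_eq {d : ℕ} (A : Matrix (Fin 4) (Fin (d + 1)) ℝ) (z : Fin 2 → ℂ) :
    paramMap A z = (A.map Complex.ofReal).mulVec (ver d z) := rfl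

theorem paramMap_smul {d : ℕ} (A : Matrix (Fin 4) (Fin (d + 1)) ℝ) (c : ℂ) (z : Fin 2 → ℂ) :
    paramMap A (c • z) = c ^ d • paramMap A z := by
  rw [paramMap_eq, ver_smul, Matrix.mulVec_smul, paramMap_eq]

theorem paramMap_cx {d : ℕ} (A : Matrix (Fin 4) (Fin (d + 1)) ℝ) (z : Fin 2 → ℝ) :
    paramMap A (cx z) = cx (A.mulVec (ver d z)) := by
  rw [cx_mulVec, cx_ver, paramMap_eq]

theorem mk_mem_linePoints {L : Submodule ℂ (Fin 4 → ℂ)} {v : Fin 4 → ℂ} (hv : v ≠ 0) :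
    Projectivization.mk ℂ v hv ∈ linePoints L ↔ v ∈ L := by
  rw [linePoints, Set.mem_ofPred_eq, Projectivization.submodule_mk, Submodule.span_singleton_le_iff_mem]

theorem curve_eq_range {d : ℕ} {A : Matrix (Fin 4) (Fin (d + 1)) ℝ}
    (hA : ∀ z : Fin 2 → ℂ, z ≠ 0 → paramMap A z ≠ 0) :
    curve A = Set.range fun z : {z : Fin 2 → ℂ // z ≠ 0} =>
      Projectivization.mk ℂ (paramMap A z.1) (hA z.1 z.2) := by
  ext x
  constructor
  · rintro ⟨z, hz, h, rfl⟩
    exact ⟨⟨z, hz⟩, rfl⟩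
  · rintro ⟨⟨z, hz⟩, rfl⟩
    exact ⟨z, hz, hA z hz, rfl⟩

/-- No contraction of `k` with a nonzero linear form vanishes. -/
def Nondegenerate (k : Fin 5 → ℂ) : Prop :=
  ∀ x : Fin 2 → ℂ, con x k = 0 → x = 0

/-- `k` lies on the secant variety of the rational normal quartic. -/
def OnSecantVariety (k : Fin 5 → ℂ) : Prop :=
  ∃ z w : Fin 2 → ℂ, z ≠ 0 ∧ w ≠ 0 ∧ con z (con w k) = 0

/-- The contractions of `k` as a linear function of the linear form. -/
noncomputable def conMap (k : Fin 5 → ℂ) : (Fin 2 → ℂ) →ₗ[ℂ] (Fin 4 → ℂ) where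
  toFun x := con x k
  map_add' x y := add_con x y k
  map_smul' c x := smul_con x c k

theorem conMap_apply (k : Fin 5 → ℂ) (x : Fin 2 → ℂ) : conMap k x = con x k := rfl

/-- The line of all contractions of `k` with linear forms. -/
noncomputable def conLine (k : Fin 5 → ℂ) : Submodule ℂ (Fin 4 → ℂ) := LinearMap.range (conMap k)

theorem con_mem_conLine (k : Fin 5 → ℂ) (x : Fin 2 → ℂ) : con x k ∈ conLine k :=
  LinearMap.mem_range_self (conMap k) x

theorem Nondegenerate.finrank_conLine {k : Fin 5 → ℂ} (hk : Nondegenerate k) :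
    Module.finrank ℂ (conLine k) = 2 := by
  rw [conLine, LinearMap.finrank_range_of_inj, Module.finrank_fin_fun]
  rw [← LinearMap.ker_eq_bot, LinearMap.ker_eq_bot']
  exact hk

theorem Nondegenerate.exists_con_eq {k : Fin 5 → ℂ} (hk : Nondegenerate k) {z w : Fin 2 → ℂ}
    (hz : z ≠ 0) (hw : w ≠ 0) (h : con z (con w k) = 0) :
    ∃ a : ℂ, a ≠ 0 ∧ con w k = a • ver 3 z := by
  obtain ⟨a, ha⟩ := eq_smul_ver_of_con_eq_zero hz h
  refine ⟨a, ?_, ha⟩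
  rintro rfl
  exact hw (hk w (by simpa using ha))

/-- A dual quartic on a tangent line of the rational normal quartic. -/
theorem exists_eq_dver_of_con_con_eq_zero {k : Fin 5 → ℂ} {z : Fin 2 → ℂ}
    (hz : z ≠ 0) (h : con z (con z k) = 0) : ∃ h : Fin 2 → ℂ, k = dver 4 z h := by
  obtain ⟨a, ha⟩ := eq_smul_ver_of_con_eq_zero hz h
  obtain ⟨g, -, hg⟩ := exists_lin_ne_zero hz
  -- The tangent vector in direction `g` has a multiple of the same contraction as `k`. What remains
  -- is a multiple of the Veronese vector itself, which is also tangent by Euler's relation, whence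
  -- the factor `1/4`.
  have : con z (k - (a / lin z g) • dver 4 z g) = 0 := by
    rw [con_sub, con_smul, con_dver_four, lin_self, zero_smul, add_zero, ha, smul_smul,
      div_mul_cancel₀ _ hg, sub_self]
  obtain ⟨b, hb⟩ := eq_smul_ver_of_con_eq_zero hz this
  refine ⟨(a / lin z g) • g + (b / 4) • z, ?_⟩
  rw [dver_add, dver_smul, dver_smul, dver_four_self, smul_smul, div_mul_cancel₀ _ (by norm_num),
    ← hb]
  abel

/-! ### The quartic read off from its kernel vector -/

theorem rank_four_mulVec_eq_zero {A : Matrix (Fin 4) (Fin (4 + 1)) ℝ} (hA : A.rank = 4)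
    {k : Fin 5 → ℝ} (hk0 : k ≠ 0) (hk : A.mulVec k = 0) {v : Fin 5 → ℂ}
    (hv : (A.map Complex.ofReal).mulVec v = 0) : ∃ c : ℂ, v = c • cx k := by
  refine exists_smul_of_finrank_ker
    (surjective_map_ofReal ((rank_eq_iff_surjective A).1 hA)) (cx_ne_zero hk0) ?_ hv
  rw [← cx_mulVec, hk, cx_zero]

theorem exists_quartic_ker {A : Matrix (Fin 4) (Fin (4 + 1)) ℝ} :
    ∃ k : Fin 5 → ℝ, k ≠ 0 ∧ A.mulVec k = 0 := by
  have h : A.mulVecLin.ker ≠ ⊥ := LinearMap.ker_ne_bot_of_finrank_lt (by simp)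
  obtain ⟨v, hv, h0⟩ := Submodule.exists_mem_ne_zero_of_ne_bot h
  exact ⟨v, h0, hv⟩

/-- A common zero `z` of the four forms is a Veronese vector in the kernel of `A`, i.e. `k` is
proportional to it, i.e. the contraction of `k` at `z` vanishes. -/
theorem isRationalQuartic_iff_nondegenerate {A : Matrix (Fin 4) (Fin (4 + 1)) ℝ} (hA : A.rank = 4)
    {k : Fin 5 → ℝ} (hk0 : k ≠ 0) (hk : A.mulVec k = 0) :
    IsRationalQuartic A ↔ Nondegenerate (cx k) := by
  constructor
  · intro h x hx
    by_contra hx0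
    obtain ⟨a, ha⟩ := eq_smul_ver_of_con_eq_zero hx0 hx
    have ha0 : a ≠ 0 := by
      rintro rfl
      exact cx_ne_zero hk0 (by simpa using ha)
    apply h.2 x hx0
    have h2 : (A.map Complex.ofReal).mulVec (cx k) = 0 := by rw [← cx_mulVec, hk, cx_zero]
    rw [ha, Matrix.mulVec_smul, smul_eq_zero] at h2
    exact h2.resolve_left ha0
  · intro h
    refine ⟨hA, fun z hz hz0 => ?_⟩
    rw [paramMap_eq] at hz0
    obtain ⟨c, hc⟩ := rank_four_mulVec_eq_zero hA hk0 hk hz0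
    have hc0 : c ≠ 0 := by
      rintro rfl
      exact ver_ne_zero (d := 4) hz (by simpa using hc)
    have h2 : con z (cx k) = 0 := by
      have h3 := con_ver (d := 3) z z
      rw [hc, lin_self, zero_smul, con_smul, smul_eq_zero] at h3
      exact h3.resolve_left hc0
    exact hz (h z h2)

/-- Projection from `k` identifies two points of the rational normal quartic iff `k` is on their
chord, and kills a tangent direction iff `k` is on the tangent line. The annihilating quadric `z`,
`w` detects both cases, the tangent one being `z ∼ w`. -/
theorem isEmbeddedCurve_iff {A : Matrix (Fin 4) (Fin (4 + 1)) ℝ} (hA : IsRationalQuartic A)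
    {k : Fin 5 → ℝ} (hk0 : k ≠ 0) (hk : A.mulVec k = 0) :
    IsEmbeddedCurve A ↔ ¬ OnSecantVariety (cx k) := by
  have hnd := (isRationalQuartic_iff_nondegenerate hA.1 hk0 hk).1 hA
  have hkc : (A.map Complex.ofReal).mulVec (cx k) = 0 := by rw [← cx_mulVec, hk, cx_zero]
  constructor
  · rintro ⟨hinj, himm⟩ ⟨z, w, hz, hw, h⟩
    by_cases hzw : lin w z = 0
    · obtain ⟨c, rfl⟩ := exists_smul_of_lin_eq_zero hz hzw
      have hc : c ≠ 0 := by rintro rfl; simp at hw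
      rw [smul_con, con_smul, smul_eq_zero] at h
      obtain ⟨g, hg⟩ := exists_eq_dver_of_con_con_eq_zero hz (h.resolve_left hc)
      have hg0 : g = 0 := by
        apply himm z hz
        rw [fderiv_paramMap_apply, map_zero, ← hg, hkc]
      apply cx_ne_zero hk0
      rw [hg, hg0]
      ext i
      simp [dver]
    · obtain ⟨a, ha0, ha⟩ := hnd.exists_con_eq hz hw h
      obtain ⟨α, β, hαβ⟩ := exists_eq_ver_add hzw ha
      have h1 : α • paramMap A z + β • paramMap A w = 0 := by
        rw [paramMap_eq, paramMap_eq, ← Matrix.mulVec_smul, ← Matrix.mulVec_smul,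
          ← Matrix.mulVec_add, ← hαβ, hkc]
      have hα : α ≠ 0 := by
        rintro rfl
        apply hw
        apply hnd
        rw [hαβ, zero_smul, zero_add, con_smul, con_ver, lin_self, zero_smul, smul_zero]
      have hβ : β ≠ 0 := by
        rintro rfl
        apply hz
        apply hnd
        rw [hαβ, zero_smul, add_zero, con_smul, con_ver, lin_self, zero_smul, smul_zero]
      obtain ⟨c, -, hc⟩ := hinj z w hz hw ⟨-(α⁻¹ * β), by simp [hα, hβ], by
        rw [neg_smul, mul_smul, ← smul_neg, ← eq_neg_of_add_eq_zero_left h1, smul_smul,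
          inv_mul_cancel₀ hα, one_smul]⟩
      apply hzw
      rw [hc, lin_smul, lin_self, mul_zero]
  · intro hk'
    refine ⟨?_, ?_⟩
    · rintro z w hz hw ⟨c, hc0, hc⟩
      have h1 : (A.map Complex.ofReal).mulVec (ver 4 z - c • ver 4 w) = 0 := by
        rw [Matrix.mulVec_sub, Matrix.mulVec_smul, ← paramMap_eq, ← paramMap_eq, hc, sub_self]
      obtain ⟨d, hd⟩ := rank_four_mulVec_eq_zero hA.1 hk0 hk h1
      have hlin : lin z w = 0 := by
        by_contra hlin
        have hd0 : d ≠ 0 := by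
          rintro rfl
          rw [zero_smul, sub_eq_add_neg, ← neg_smul] at hd
          have := (eq_zero_of_smul_ver_add (d := 3) hlin
            (a := 1) (b := -c) (by simpa using hd)).1
          exact one_ne_zero this
        apply hk'
        refine ⟨z, w, hz, hw, ?_⟩
        have h2 := congrArg (fun v : Fin 5 → ℂ => con z (con w v)) hd
        simp only [con_sub, con_smul, con_ver, lin_self, zero_smul, smul_zero, sub_zero] at h2
        exact (smul_eq_zero.1 h2.symm).resolve_left hd0
      obtain ⟨e, he⟩ := exists_smul_of_lin_eq_zero hw hlin
      exact ⟨e, by rintro rfl; exact hz (by simpa using he), he⟩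
    · intro z hz
      rw [← ContinuousLinearMap.coe_coe, ← LinearMap.ker_eq_bot, LinearMap.ker_eq_bot']
      intro g hg
      rw [ContinuousLinearMap.coe_coe, fderiv_paramMap_apply] at hg
      obtain ⟨d, hd⟩ := rank_four_mulVec_eq_zero hA.1 hk0 hk hg
      have h1 := congrArg (con z) hd
      have h2 := congrArg (con z) h1
      simp only [con_dver_four, con_smul, con_ver, lin_self, zero_smul, smul_zero,
        add_zero] at h1 h2
      have hd0 : d = 0 := by
        by_contra hd0
        exact hk' ⟨z, z, hz, hz, (smul_eq_zero.1 h2.symm).resolve_left hd0⟩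
      rw [hd0, zero_smul, smul_eq_zero] at h1
      obtain ⟨e, rfl⟩ := exists_smul_of_lin_eq_zero (w := g) hz
        (by rw [lin_swap, h1.resolve_right (ver_ne_zero hz), neg_zero])
      rw [hd0, zero_smul, dver_smul, dver_four_self, smul_smul, smul_eq_zero] at hd
      have := hd.resolve_right (ver_ne_zero hz)
      have he : e = 0 := by simpa using this
      simp [he]

/-! ### The twisted cubic and the line of contractions -/

theorem twistedCubic_injective {B : Matrix (Fin 4) (Fin (3 + 1)) ℝ} (hB : IsTwistedCubic B) :
    Function.Injective (B.map Complex.ofReal).mulVecLin :=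
  LinearMap.injective_iff_surjective.2
    (surjective_map_ofReal ((rank_eq_iff_surjective B).1 hB))

theorem twistedCubic_paramMap_ne_zero {B : Matrix (Fin 4) (Fin (3 + 1)) ℝ} (hB : IsTwistedCubic B)
    (z : Fin 2 → ℂ) (hz : z ≠ 0) : paramMap B z ≠ 0 := fun h =>
  ver_ne_zero (d := 3) hz (twistedCubic_injective hB (h.trans (map_zero _).symm))

/-- The point `z` of the cubic is on the line iff the contraction of `k` at some `w` is a nonzero
multiple of `ver 3 z`, and this is the condition that contracting once more at `z` gives zero. -/
theorem disjoint_conLine_iff {B : Matrix (Fin 4) (Fin (3 + 1)) ℝ} (hB : IsTwistedCubic B)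
    {k : Fin 5 → ℂ} (hk : Nondegenerate k) :
    Disjoint (linePoints ((conLine k).map (B.map Complex.ofReal).mulVecLin)) (curve B) ↔
      ¬ OnSecantVariety k := by
  rw [Set.disjoint_right]
  constructor
  · rintro h ⟨z, w, hz, hw, hzw⟩
    obtain ⟨a, ha0, ha⟩ := hk.exists_con_eq hz hw hzw
    have hz' := twistedCubic_paramMap_ne_zero hB z hz
    refine h ⟨z, hz, hz', rfl⟩ ((mk_mem_linePoints hz').2 ⟨ver 3 z, ?_, rfl⟩)
    rw [← one_smul ℂ (ver 3 z), ← inv_mul_cancel₀ ha0, mul_smul, ← ha]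
    exact Submodule.smul_mem _ _ (con_mem_conLine k w)
  · rintro h _ ⟨z, hz, hz', rfl⟩ hmem
    obtain ⟨p, ⟨w, rfl⟩, hp⟩ := (mk_mem_linePoints hz').1 hmem
    have hzw : con w k = ver 3 z := twistedCubic_injective hB hp
    refine h ⟨z, w, hz, ?_, ?_⟩
    · rintro rfl
      rw [zero_con] at hzw
      exact ver_ne_zero hz hzw.symm
    · rw [hzw, con_ver, lin_self, zero_smul]

theorem isSecantLine_conLine {B : Matrix (Fin 4) (Fin (3 + 1)) ℝ} (hB : IsTwistedCubic B)
    {k : Fin 5 → ℂ} (hk : Nondegenerate k) (h : OnSecantVariety k) :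
    IsSecantLine B ((conLine k).map (B.map Complex.ofReal).mulVecLin) := by
  have hfin : Module.finrank ℂ ((conLine k).map (B.map Complex.ofReal).mulVecLin) = 2 := by
    rw [← hk.finrank_conLine]
    exact (Submodule.equivMapOfInjective _ (twistedCubic_injective hB) _).symm.finrank_eq
  refine ⟨hfin, ?_⟩
  obtain ⟨z, w, hz, hw, h⟩ := h
  by_cases hzw : lin z w = 0
  · right
    obtain ⟨c, rfl⟩ := exists_smul_of_lin_eq_zero hw hzw
    have hc : c ≠ 0 := by rintro rfl; simp at hz
    rw [smul_con, smul_eq_zero] at h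
    obtain ⟨g, hg⟩ := exists_eq_dver_of_con_con_eq_zero hw (h.resolve_left hc)
    refine ⟨w, hw, ?_⟩
    apply Submodule.eq_of_le_of_finrank_le
    · rintro _ ⟨_, ⟨x, rfl⟩, rfl⟩
      -- The Leibniz rule writes the contraction of `dver 4 w g` at `x` as a derivative of the
      -- cubic; the Veronese term is absorbed by Euler's relation in degree 3.
      refine ⟨(lin x g / 3) • w + lin x w • g, ?_⟩
      rw [ContinuousLinearMap.coe_coe, fderiv_paramMap_apply, dver_add, dver_smul, dver_smul,
        dver_three_self, smul_smul, div_mul_cancel₀ _ (by norm_num), ← con_dver_four, ← hg]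
      rfl
    · rw [hfin]
      exact (LinearMap.finrank_range_le _).trans (by simp)
  · left
    obtain ⟨a, ha0, ha⟩ := hk.exists_con_eq hz hw h
    obtain ⟨b, hb0, hb⟩ := hk.exists_con_eq hw hz (by rw [con_comm]; exact h)
    refine ⟨z, w, ?_, ?_⟩
    · rw [LinearIndependent.pair_iff]
      intro s t hst
      have h1 := congrArg (lin z) hst
      have h2 := congrArg (lin w) hst
      have h3 : ∀ v : Fin 2 → ℂ, lin v 0 = 0 := fun v => by simp [lin]
      simp only [lin_add, lin_smul, lin_self, h3, mul_zero, zero_add, add_zero] at h1 h2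
      exact ⟨(mul_eq_zero.1 h2).resolve_right (lin_ne_zero_swap hzw),
        (mul_eq_zero.1 h1).resolve_right hzw⟩
    · obtain ⟨α, β, hαβ⟩ := exists_eq_ver_add (lin_ne_zero_swap hzw) ha
      apply Submodule.eq_of_le_of_finrank_le
      · rintro _ ⟨_, ⟨x, rfl⟩, rfl⟩
        rw [conMap_apply, hαβ, con_add, con_smul, con_smul, con_ver, con_ver, map_add, map_smul,
          map_smul, map_smul, map_smul]
        refine add_mem (Submodule.smul_mem _ _ (Submodule.smul_mem _ _ ?_))
          (Submodule.smul_mem _ _ (Submodule.smul_mem _ _ ?_))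
        · exact Submodule.subset_span (Or.inl rfl)
        · exact Submodule.subset_span (Or.inr rfl)
      · rw [hfin]
        have := finrank_span_le_card (R := ℂ) ({paramMap B z, paramMap B w} : Set (Fin 4 → ℂ))
        refine this.trans ?_
        rw [Set.toFinset_insert, Set.toFinset_singleton]
        exact Finset.card_le_two

/-- A secant line of a twisted cubic is annihilated by a quadric. -/
theorem IsSecantLine.exists_con_con_eq_zero {B : Matrix (Fin 4) (Fin (3 + 1)) ℝ}
    (hB : IsTwistedCubic B) {L : Submodule ℂ (Fin 4 → ℂ)} (hL : IsSecantLine B L) :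
    ∃ z w : Fin 2 → ℂ, z ≠ 0 ∧ w ≠ 0 ∧
      ∀ p : Fin 4 → ℂ, (B.map Complex.ofReal).mulVec p ∈ L → con z (con w p) = 0 := by
  obtain ⟨-, ⟨z, w, hzw, rfl⟩ | ⟨z, hz, rfl⟩⟩ := hL
  · refine ⟨z, w, hzw.ne_zero 0, hzw.ne_zero 1, fun p hp => ?_⟩
    obtain ⟨a, b, hab⟩ := Submodule.mem_span_pair.1 hp
    rw [paramMap_eq, paramMap_eq, ← Matrix.mulVec_smul, ← Matrix.mulVec_smul,
      ← Matrix.mulVec_add] at hab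
    rw [← twistedCubic_injective hB hab, con_add, con_smul, con_smul, con_ver, con_ver, lin_self,
      zero_smul, smul_zero, add_zero, con_smul, con_smul, con_ver, lin_self, zero_smul, smul_zero,
      smul_zero]
  · refine ⟨z, z, hz, hz, fun p hp => ?_⟩
    obtain ⟨g, hg⟩ := hp
    rw [ContinuousLinearMap.coe_coe, fderiv_paramMap_apply] at hg
    rw [← twistedCubic_injective hB hg, con_dver_three, lin_self, zero_smul, add_zero, con_smul,
      con_ver, lin_self, zero_smul, smul_zero]

/-! ### Companion cameras of a quartic and a cubic -/

theorem surjective_of_mul_eq {l m n : Type*} [Fintype m] [Fintype n] [Fintype l]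
    {R : Matrix l n ℝ} {T : Matrix l m ℝ} {W : Matrix m n ℝ} (h : R = T * W)
    (hR : Function.Surjective R.mulVecLin) : Function.Surjective T.mulVecLin := by
  intro y
  obtain ⟨x, hx⟩ := hR y
  exact ⟨W.mulVec x, by rw [← hx, h]; simp⟩

theorem surjective_mul {l m n : Type*} [Fintype m] [Fintype n] [Fintype l]
    {T : Matrix l m ℝ} {W : Matrix m n ℝ} (hT : Function.Surjective T.mulVecLin)
    (hW : Function.Surjective W.mulVecLin) : Function.Surjective (T * W).mulVecLin := by
  rw [Matrix.mulVecLin_mul]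
  exact hT.comp hW

/-- The kernel of `shift 3 w` is spanned by `ver 4 w`, whose image under `A` is the center of `P`.
-/
theorem exists_cubic_camera {A : Matrix (Fin 4) (Fin (4 + 1)) ℝ} (hA : A.rank = 4)
    {P : Camera} {w : Fin 2 → ℝ} (hw : w ≠ 0) (hP : P.toLin (paramMap A (cx w)) = 0) :
    ∃ Q : Camera, P.mat * A = Q.mat * shift 3 w := by
  obtain ⟨T, hT⟩ := exists_mul_eq_of_ker_le (P.mat * A) (shift 3 w) (by
    intro k hk
    rw [shift_mulVec] at hk
    obtain ⟨a, rfl⟩ := eq_smul_ver_of_con_eq_zero hw hk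
    rw [paramMap_cx, Camera.toLin_cx, ← cx_zero] at hP
    rw [Matrix.mulVec_smul, ← Matrix.mulVec_mulVec, cx_injective hP, smul_zero])
  refine ⟨Camera.ofSurjective T (surjective_of_mul_eq hT ?_), hT⟩
  exact surjective_mul P.surjective ((rank_eq_iff_surjective A).1 hA)

/-- The reverse passage: the kernel of `A` is spanned by `k`, whose contraction at `w` gives the
center of `Q`. -/
theorem exists_quartic_camera {A : Matrix (Fin 4) (Fin (4 + 1)) ℝ} (hA : A.rank = 4)
    {k : Fin 5 → ℝ} (hk0 : k ≠ 0) (hk : A.mulVec k = 0)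
    {B : Matrix (Fin 4) (Fin (3 + 1)) ℝ} (hB : IsTwistedCubic B) {Q : Camera}
    {w : Fin 2 → ℝ} (hw : w ≠ 0) (hQ : (Q.mat * B).mulVec (con w k) = 0) :
    ∃ P : Camera, P.mat * A = Q.mat * B * shift 3 w := by
  obtain ⟨T, hT⟩ := exists_mul_eq_of_ker_le (Q.mat * B * shift 3 w) A (by
    intro v hv
    obtain ⟨c, rfl⟩ := exists_smul_of_finrank_ker ((rank_eq_iff_surjective A).1 hA) hk0 hk hv
    rw [Matrix.mulVec_smul, ← Matrix.mulVec_mulVec, shift_mulVec, hQ, smul_zero])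
  refine ⟨Camera.ofSurjective T (surjective_of_mul_eq hT ?_), hT.symm⟩
  exact surjective_mul (surjective_mul Q.surjective ((rank_eq_iff_surjective B).1 hB))
    (shift_surjective hw)

section Companion

variable {A : Matrix (Fin 4) (Fin (4 + 1)) ℝ} {B : Matrix (Fin 4) (Fin (3 + 1)) ℝ}
  {k : Fin 5 → ℝ}

/-- The factor vanishes exactly at the parameter of the center of `P`, where the quartic point may
have any image. -/
theorem companion_image {P Q : Camera} {w : Fin 2 → ℝ}
    (h : P.mat * A = Q.mat * B * shift 3 w) (z : Fin 2 → ℂ) :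
    P.toLin (paramMap A z) = lin (cx w) z • Q.toLin (paramMap B z) := by
  rw [Camera.toLin_apply, Camera.toLin_apply, paramMap_eq, paramMap_eq, Matrix.mulVec_mulVec,
    ← map_ofReal_mul, h, map_ofReal_mul, map_ofReal_mul, shift_map, ← Matrix.mulVec_mulVec,
    shift_mulVec, con_ver, Matrix.mulVec_smul, Matrix.mulVec_mulVec]

/-- The defining relation evaluated at `k`, which `A` kills. -/
theorem companion_center {P Q : Camera} {w : Fin 2 → ℝ} (hk : A.mulVec k = 0)
    (h : P.mat * A = Q.mat * B * shift 3 w) :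
    Q.toLin ((B.map Complex.ofReal).mulVec (con (cx w) (cx k))) = 0 := by
  rw [Camera.toLin_apply, Matrix.mulVec_mulVec, ← shift_mulVec, ← shift_map, Matrix.mulVec_mulVec,
    ← map_ofReal_mul, ← map_ofReal_mul, ← h, ← cx_mulVec, ← Matrix.mulVec_mulVec, hk,
    Matrix.mulVec_zero, cx_zero]

theorem companion_center_left {P Q : Camera} {w : Fin 2 → ℝ}
    (h : P.mat * A = Q.mat * B * shift 3 w) : P.toLin (paramMap A (cx w)) = 0 := by
  rw [companion_image h, lin_self, zero_smul]

theorem companion_lin_ne_zero (hA : IsRationalQuartic A) {P₁ P₂ Q₁ Q₂ : Camera}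
    (hP : P₁.center ≠ P₂.center) {w₁ w₂ : Fin 2 → ℝ} (hw₁ : w₁ ≠ 0) (hw₂ : w₂ ≠ 0)
    (h₁ : P₁.mat * A = Q₁.mat * B * shift 3 w₁) (h₂ : P₂.mat * A = Q₂.mat * B * shift 3 w₂) :
    lin (cx w₁) (cx w₂) ≠ 0 := by
  intro h
  obtain ⟨c, hc⟩ := exists_smul_of_lin_eq_zero (cx_ne_zero hw₂) h
  apply hP
  apply Camera.center_eq_of (hA.2 _ (cx_ne_zero hw₁)) (companion_center_left h₁)
  rw [hc, paramMap_smul, map_smul, companion_center_left h₂, smul_zero]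

/-- Contractions of `k` at the parameters of two distinct centers cannot both be the Veronese
points of the respective other parameter. -/
theorem companion_not_both (hA : IsRationalQuartic A) (hk0 : k ≠ 0) (hk : A.mulVec k = 0)
    {P₁ P₂ Q₁ Q₂ : Camera} (hP : P₁.center ≠ P₂.center) {w₁ w₂ : Fin 2 → ℝ} (hw₁ : w₁ ≠ 0)
    (hw₂ : w₂ ≠ 0) (h₁ : P₁.mat * A = Q₁.mat * B * shift 3 w₁)
    (h₂ : P₂.mat * A = Q₂.mat * B * shift 3 w₂) {α β : ℂ}
    (h : cx k = α • ver 4 (cx w₁) + β • ver 4 (cx w₂)) : False := by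
  have hnd := (isRationalQuartic_iff_nondegenerate hA.1 hk0 hk).1 hA
  have hα : α ≠ 0 := by
    rintro rfl
    apply cx_ne_zero hw₂
    apply hnd
    rw [h, zero_smul, zero_add, con_smul, con_ver, lin_self, zero_smul, smul_zero]
  have hkc : (A.map Complex.ofReal).mulVec (cx k) = 0 := by rw [← cx_mulVec, hk, cx_zero]
  -- The two centers would be proportional: apply `P₂` to the resulting relation between the quartic
  -- points at `w₁` and `w₂`.
  rw [h, Matrix.mulVec_add, Matrix.mulVec_smul, Matrix.mulVec_smul, ← paramMap_eq,
    ← paramMap_eq] at hkc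
  apply hP
  apply Camera.center_eq_of (hA.2 _ (cx_ne_zero hw₁)) (companion_center_left h₁)
  have := congrArg P₂.toLin hkc
  rw [map_add, map_smul, map_smul, companion_center_left h₂, smul_zero, add_zero, map_zero,
    smul_eq_zero] at this
  exact this.resolve_left hα

/-- `P₂` sees the center of `P₁` where `Q₂` sees the cubic point at `w₁`. The hypothesis `h` keeps
that point off the line of contractions, which is the base line of `Q₁` and `Q₂`. -/
theorem companion_distinguishable_of_ne (hA : IsRationalQuartic A) (hB : IsTwistedCubic B)
    (hk0 : k ≠ 0) (hk : A.mulVec k = 0)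
    {P₁ P₂ Q₁ Q₂ : Camera} {w₁ w₂ : Fin 2 → ℝ} (hw₁ : w₁ ≠ 0)
    (hlin : lin (cx w₁) (cx w₂) ≠ 0) (h₁ : P₁.mat * A = Q₁.mat * B * shift 3 w₁)
    (h₂ : P₂.mat * A = Q₂.mat * B * shift 3 w₂) (h : ∀ x, con x (cx k) ≠ ver 3 (cx w₁)) :
    Distinguishable P₁ P₂ Q₁ Q₂ := by
  have hnd := (isRationalQuartic_iff_nondegenerate hA.1 hk0 hk).1 hA
  refine distinguishable_of_epipole (c := paramMap A (cx w₁)) (u := paramMap B (cx w₁))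
    (y := Q₂.mat.mulVec (B.mulVec (ver 3 w₁))) (s := lin (cx w₂) (cx w₁))
    (hA.2 _ (cx_ne_zero hw₁)) (companion_center_left h₁)
    ?_ ?_ (companion_center hk h₁) (companion_center hk h₂) ?_
  · rw [companion_image h₂, ← Camera.toLin_cx, ← paramMap_cx]
  · rw [← Camera.toLin_cx, ← paramMap_cx]
  · intro a b d habd
    rw [paramMap_eq, ← Matrix.mulVec_smul, ← Matrix.mulVec_smul, ← Matrix.mulVec_smul,
      ← Matrix.mulVec_add, ← Matrix.mulVec_add, ← smul_con, ← smul_con, add_assoc, ← add_con] at habd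
    have h0 := twistedCubic_injective hB (habd.trans (map_zero _).symm)
    have ha : a = 0 := by
      by_contra ha
      apply h (-a⁻¹ • (b • cx w₁ + d • cx w₂))
      rw [smul_con, neg_smul, ← smul_neg, ← eq_neg_of_add_eq_zero_left h0, smul_smul,
        inv_mul_cancel₀ ha, one_smul]
    rw [ha, zero_smul, zero_add] at h0
    have h1 := hnd _ h0
    have e1 := congrArg (lin (cx w₁)) h1
    have e2 := congrArg (lin (cx w₂)) h1
    have h3 : ∀ v : Fin 2 → ℂ, lin v 0 = 0 := fun v => by simp [lin]
    simp only [lin_add, lin_smul, lin_self, h3, mul_zero, zero_add, add_zero] at e1 e2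
    exact ⟨ha, (mul_eq_zero.1 e2).resolve_right (lin_ne_zero_swap hlin),
      (mul_eq_zero.1 e1).resolve_right hlin⟩

/-- The epipole in one of the two views separates the pairs, unless the cubic points at `w₁` and
`w₂` are both on the line. Then `k` is on the chord of `w₁` and `w₂`, so the quartic has a node
there and the two centers of the `P` pair coincide. -/
theorem companion_distinguishable (hA : IsRationalQuartic A) (hB : IsTwistedCubic B)
    (hk0 : k ≠ 0) (hk : A.mulVec k = 0)
    {P₁ P₂ Q₁ Q₂ : Camera} (hP : P₁.center ≠ P₂.center) {w₁ w₂ : Fin 2 → ℝ} (hw₁ : w₁ ≠ 0)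
    (hw₂ : w₂ ≠ 0) (h₁ : P₁.mat * A = Q₁.mat * B * shift 3 w₁)
    (h₂ : P₂.mat * A = Q₂.mat * B * shift 3 w₂) : Distinguishable P₁ P₂ Q₁ Q₂ := by
  have hlin := companion_lin_ne_zero hA hP hw₁ hw₂ h₁ h₂
  by_cases e₁ : ∀ x, con x (cx k) ≠ ver 3 (cx w₁)
  · exact companion_distinguishable_of_ne hA hB hk0 hk hw₁ hlin h₁ h₂ e₁
  by_cases e₂ : ∀ x, con x (cx k) ≠ ver 3 (cx w₂)
  · exact (companion_distinguishable_of_ne hA hB hk0 hk hw₂ (lin_ne_zero_swap hlin) h₂ h₁ e₂).swap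
  push Not at e₁ e₂
  obtain ⟨x, hx⟩ := e₁
  obtain ⟨y, hy⟩ := e₂
  obtain ⟨-, -, α, β, h⟩ := eq_ver_add_of_con_of_con (d := 1) hlin one_ne_zero one_ne_zero
    (by rw [one_smul]; exact hx) (by rw [one_smul]; exact hy)
  exact (companion_not_both hA hk0 hk hP hw₁ hw₂ h₁ h₂ h).elim

theorem companion_conjugateAlong {n : ℕ} (hn : 2 ≤ n) (hA : IsRationalQuartic A)
    (hB : IsTwistedCubic B) (hk0 : k ≠ 0) (hk : A.mulVec k = 0) {P Q : CameraTuple n}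
    {w : Fin n → Fin 2 → ℝ} (hw : ∀ i, w i ≠ 0)
    (h : ∀ i, (P.cam i).mat * A = (Q.cam i).mat * B * shift 3 (w i)) :
    ConjugateAlong P (curve A) Q (curve B) ∧ ConjugateAlong Q (curve B) P (curve A) := by
  have hD : ∀ i j, i ≠ j → Distinguishable (P.cam i) (P.cam j) (Q.cam i) (Q.cam j) :=
    fun i j hij => companion_distinguishable hA hB hk0 hk (fun e => hij (P.distinct e))
      (hw i) (hw j) (h i) (h j)
  have hI : HaveCommonImages P Q (fun z : {z : Fin 2 → ℂ // z ≠ 0} => paramMap A z.1)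
      (fun z => paramMap B z.1) := fun i z =>
    ⟨(Q.cam i).toLin (paramMap B z.1), _, 1, companion_image (h i) z.1, (one_smul _ _).symm⟩
  rw [curve_eq_range hA.2, curve_eq_range (twistedCubic_paramMap_ne_zero hB)]
  exact ⟨hI.conjugateAlong hn _ _ hD, hI.symm.conjugateAlong hn _ _ fun i j hij => (hD i j hij).symm⟩

theorem companion_center_mem {Q : Camera} (hB : IsTwistedCubic B) {k : Fin 5 → ℂ}
    (hnd : Nondegenerate k) {x : Fin 2 → ℂ} (hx : x ≠ 0)
    (h : Q.toLin ((B.map Complex.ofReal).mulVec (con x k)) = 0) :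
    Q.center ∈ linePoints ((conLine k).map (B.map Complex.ofReal).mulVecLin) := by
  have h0 : (B.map Complex.ofReal).mulVec (con x k) ≠ 0 := fun h0 =>
    hx (hnd x (twistedCubic_injective hB (h0.trans (map_zero _).symm)))
  rw [(Q.center_eq_mk_iff h0).2 h, mk_mem_linePoints]
  exact ⟨_, con_mem_conLine _ _, rfl⟩

theorem companion_center_ne {Q₁ Q₂ : Camera} (hB : IsTwistedCubic B) {k : Fin 5 → ℂ}
    (hnd : Nondegenerate k) {x₁ x₂ : Fin 2 → ℂ} (hlin : lin x₁ x₂ ≠ 0)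
    (h₁ : Q₁.toLin ((B.map Complex.ofReal).mulVec (con x₁ k)) = 0)
    (h₂ : Q₂.toLin ((B.map Complex.ofReal).mulVec (con x₂ k)) = 0) : Q₁.center ≠ Q₂.center := by
  have hne : ∀ x, x ≠ 0 → (B.map Complex.ofReal).mulVec (con x k) ≠ 0 := fun x hx h0 =>
    hx (hnd x (twistedCubic_injective hB (h0.trans (map_zero _).symm)))
  refine Camera.center_ne_of (hne _ (ne_zero_of_lin_left hlin)) h₁
    (hne _ (ne_zero_of_lin_right hlin)) h₂ fun c hc => hlin ?_
  rw [← Matrix.mulVec_smul, ← smul_con] at hc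
  have h3 := twistedCubic_injective hB hc
  have h4 := hnd (x₁ - c • x₂) (by rw [sub_con, h3, sub_self])
  rw [sub_eq_zero.1 h4, smul_lin, lin_self, mul_zero]

/-- If the center of a companion camera is on the cubic, then a contraction of `k` is Veronese. -/
theorem exists_con_eq_ver_of_center_mem {Q : Camera} (hB : IsTwistedCubic B) {k : Fin 5 → ℂ}
    (hnd : Nondegenerate k) {x : Fin 2 → ℂ} (hx : x ≠ 0)
    (h : Q.toLin ((B.map Complex.ofReal).mulVec (con x k)) = 0) (hQ : Q.center ∈ curve B) :
    ∃ (z : Fin 2 → ℂ) (a : ℂ), z ≠ 0 ∧ a ≠ 0 ∧ con x k = a • ver 3 z := by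
  obtain ⟨z, hz, hz', hzc⟩ := hQ
  obtain ⟨a, ha⟩ := Q.exists_smul hz' ((Q.center_eq_mk_iff hz').1 hzc) h
  rw [paramMap_eq, ← Matrix.mulVec_smul] at ha
  have h1 := twistedCubic_injective hB ha
  refine ⟨z, a, hz, ?_, h1⟩
  rintro rfl
  exact hx (hnd x (by simpa using h1))

/-- Two centers on the cubic force `k` onto the chord of their parameters, with the contraction at
each being the Veronese point of the other; again the centers on the quartic would coincide. -/
theorem companion_atMostOneCenterIn {n : ℕ} (hA : IsRationalQuartic A)
    (hB : IsTwistedCubic B) (hk0 : k ≠ 0) (hk : A.mulVec k = 0) {P Q : CameraTuple n}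
    {w : Fin n → Fin 2 → ℝ} (hw : ∀ i, w i ≠ 0)
    (h : ∀ i, (P.cam i).mat * A = (Q.cam i).mat * B * shift 3 (w i)) :
    Q.AtMostOneCenterIn (curve B) := by
  intro i j hi hj
  by_contra hij
  have hP : (P.cam i).center ≠ (P.cam j).center := fun e => hij (P.distinct e)
  have hnd := (isRationalQuartic_iff_nondegenerate hA.1 hk0 hk).1 hA
  have hlin := companion_lin_ne_zero hA hP (hw i) (hw j) (h i) (h j)
  obtain ⟨z, a, hz, ha0, ha⟩ := exists_con_eq_ver_of_center_mem hB hnd (cx_ne_zero (hw i))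
    (companion_center hk (h i)) hi
  obtain ⟨y, b, hy, hb0, hb⟩ := exists_con_eq_ver_of_center_mem hB hnd (cx_ne_zero (hw j))
    (companion_center hk (h j)) hj
  -- If both contractions were the same point, a nontrivial combination of `w i` and `w j` would
  -- contract `k` to zero.
  have hzy : lin z y ≠ 0 := by
    intro hzy
    obtain ⟨c, rfl⟩ := exists_smul_of_lin_eq_zero hy hzy
    rw [ver_smul, smul_smul] at ha
    have h4 := hnd (b • cx (w i) - (a * c ^ 3) • cx (w j)) (by
      rw [sub_con, smul_con, smul_con, ha, hb, smul_smul, smul_smul, mul_comm b, sub_self])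
    have := congrArg (lin (cx (w j))) h4
    have h3 : ∀ v : Fin 2 → ℂ, lin v 0 = 0 := fun v => by simp [lin]
    rw [lin_sub, lin_smul, lin_smul, lin_self, mul_zero, sub_zero, h3] at this
    exact mul_ne_zero hb0 (lin_ne_zero_swap hlin) this
  obtain ⟨e1, e2, α, β, hk'⟩ := eq_ver_add_of_con_of_con (d := 1) hzy ha0 hb0 ha hb
  obtain ⟨c, rfl⟩ := exists_smul_of_lin_eq_zero (w := y) (cx_ne_zero (hw i))
    (by rw [lin_swap, e1, neg_zero])
  obtain ⟨d, rfl⟩ := exists_smul_of_lin_eq_zero (w := z) (cx_ne_zero (hw j))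
    (by rw [lin_swap, e2, neg_zero])
  rw [ver_smul, ver_smul, smul_smul, smul_smul] at hk'
  exact companion_not_both hA hk0 hk hP (hw i) (hw j) (h i) (h j) (hk'.trans (add_comm _ _))

end Companion

/-! ### Points and cameras on a rational quartic -/

theorem exists_real_of_lin_star_eq_zero {u : Fin 2 → ℂ} (hu : u ≠ 0) (h : lin u (star u) = 0) :
    ∃ (w : Fin 2 → ℝ) (c : ℂ), w ≠ 0 ∧ c ≠ 0 ∧ u = c • cx w := by
  simp only [lin, Pi.star_apply, sub_eq_zero] at h
  by_cases h0 : u 0 = 0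
  · have h1 : u 1 ≠ 0 := fun h1 => hu (by ext i; fin_cases i <;> simpa)
    refine ⟨![0, 1], u 1, by simp, h1, ?_⟩
    ext i
    fin_cases i <;> simp [cx, h0]
  · have hr : star (u 1 / u 0) = u 1 / u 0 := by
      have hs : star (u 0) ≠ 0 := by simpa using h0
      rw [star_div₀, div_eq_div_iff hs h0]
      linear_combination -h
    obtain ⟨r, hr⟩ := Complex.conj_eq_iff_real.1 hr
    refine ⟨![1, r], u 0, by simp, h0, ?_⟩
    ext i
    fin_cases i
    · simp [cx]
    · simp only [cx, Fin.mk_one, Matrix.cons_val_one, Matrix.cons_val_fin_one, Pi.smul_apply,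
        smul_eq_mul, ← hr]
      field_simp

theorem star_map_mulVec {m n : Type*} [Fintype n] (M : Matrix m n ℝ) (v : n → ℂ) :
    star ((M.map Complex.ofReal).mulVec v) = (M.map Complex.ofReal).mulVec (star v) := by
  ext i
  simp [Matrix.mulVec, dotProduct]

theorem star_ver (d : ℕ) (z : Fin 2 → ℂ) : star (ver d z) = ver d (star z) := by
  ext i
  simp [ver]

theorem star_con {d : ℕ} (x : Fin 2 → ℂ) (k : Fin (d + 2) → ℂ) :
    star (con x k) = con (star x) (star k) := by
  ext i
  simp [con]

theorem star_cx {ι : Type*} (v : ι → ℝ) : star (cx v) = cx v := by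
  ext i
  simp [cx]

theorem eq_cx_of_star_eq {ι : Type*} {v : ι → ℂ} (h : star v = v) : ∃ w : ι → ℝ, v = cx w := by
  refine ⟨fun i => (v i).re, ?_⟩
  ext i
  exact (Complex.conj_eq_iff_re.1 (congrFun h i)).symm

/-- A camera center on a real curve is either on its real branch, or the common image
of two complex conjugate parameters. -/
theorem Camera.center_mem_curve {d : ℕ} {A : Matrix (Fin 4) (Fin (d + 1)) ℝ} {P : Camera}
    (hP : P.center ∈ curve A) :
    (∃ w : Fin 2 → ℝ, w ≠ 0 ∧ P.toLin (paramMap A (cx w)) = 0) ∨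
    ∃ u : Fin 2 → ℂ, lin u (star u) ≠ 0 ∧ P.toLin (paramMap A u) = 0 ∧
      P.toLin (paramMap A (star u)) = 0 := by
  obtain ⟨u, hu, hu', h⟩ := hP
  have hPu := (P.center_eq_mk_iff hu').1 h
  by_cases hs : lin u (star u) = 0
  · left
    obtain ⟨w, c, hw, hc, rfl⟩ := exists_real_of_lin_star_eq_zero hu hs
    refine ⟨w, hw, ?_⟩
    rw [paramMap_smul, map_smul, smul_eq_zero] at hPu
    exact hPu.resolve_left (pow_ne_zero _ hc)
  · right
    refine ⟨u, hs, hPu, ?_⟩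
    rw [paramMap_eq, ← star_ver, ← star_map_mulVec, Camera.toLin_apply, ← star_map_mulVec,
      ← paramMap_eq, ← Camera.toLin_apply, hPu, star_zero]

theorem exists_of_center_mem_realBranch {d : ℕ} {A : Matrix (Fin 4) (Fin (d + 1)) ℝ} {P : Camera}
    (hP : P.center ∈ realBranch A) :
    ∃ w : Fin 2 → ℝ, w ≠ 0 ∧ P.toLin (paramMap A (cx w)) = 0 := by
  obtain ⟨w, hw, hw', h⟩ := hP
  exact ⟨w, hw, (P.center_eq_mk_iff hw').1 h⟩

theorem isTwistedCubic_one : IsTwistedCubic (1 : Matrix (Fin 4) (Fin (3 + 1)) ℝ) :=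
  Matrix.rank_one.trans (Fintype.card_fin 4)

/-- The standard cubic `B = 1` suffices, since only the cameras and the line have to be adapted to
the quartic. -/
theorem exists_companion_cubic {n : ℕ} {A : Matrix (Fin 4) (Fin (4 + 1)) ℝ}
    (hA : IsRationalQuartic A) {k : Fin 5 → ℝ} (hk0 : k ≠ 0) (hk : A.mulVec k = 0)
    {P : CameraTuple n} (hP : ∀ i, ∃ w : Fin 2 → ℝ, w ≠ 0 ∧ (P.cam i).toLin (paramMap A (cx w)) = 0) :
    ∃ (Q : CameraTuple n) (w : Fin n → Fin 2 → ℝ), (∀ i, w i ≠ 0) ∧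
      ∀ i, (P.cam i).mat * A =
        (Q.cam i).mat * (1 : Matrix (Fin 4) (Fin (3 + 1)) ℝ) * shift 3 (w i) := by
  choose w hw hPw using hP
  choose Q hQ using fun i => exists_cubic_camera hA.1 (hw i) (hPw i)
  have hQ' : ∀ i, (P.cam i).mat * A =
      (Q i).mat * (1 : Matrix (Fin 4) (Fin (3 + 1)) ℝ) * shift 3 (w i) := fun i => by
    rw [hQ i]; exact congrArg (· * _) (Matrix.mul_one _).symm
  have hnd := (isRationalQuartic_iff_nondegenerate hA.1 hk0 hk).1 hA
  refine ⟨⟨Q, fun i j hij => ?_⟩, w, hw, hQ'⟩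
  by_contra hne
  have hP : (P.cam i).center ≠ (P.cam j).center := fun e => hne (P.distinct e)
  exact companion_center_ne isTwistedCubic_one hnd
    (companion_lin_ne_zero hA hP (hw i) (hw j) (hQ' i) (hQ' j))
    (companion_center hk (hQ' i)) (companion_center hk (hQ' j)) hij

theorem smoothQuartic_conjugateAlong {n : ℕ} (hn : 2 ≤ n) {A : Matrix (Fin 4) (Fin (4 + 1)) ℝ}
    (hA : IsSmoothRationalQuartic A) {P : CameraTuple n} (hP : P.CentersIn (curve A)) :
    ∃ (B : Matrix (Fin 4) (Fin (3 + 1)) ℝ) (L : Submodule ℂ (Fin 4 → ℂ)) (Q : CameraTuple n),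
      IsTwistedCubic B ∧ IsLine L ∧ Disjoint (linePoints L) (curve B) ∧
      Q.CentersIn (linePoints L) ∧ ConjugateAlong P (curve A) Q (curve B) := by
  obtain ⟨k, hk0, hk⟩ := exists_quartic_ker (A := A)
  have hnd := (isRationalQuartic_iff_nondegenerate hA.1.1 hk0 hk).1 hA.1
  obtain ⟨Q, w, hw, hQ⟩ := exists_companion_cubic hA.1 hk0 hk (P := P) fun i => by
    refine (Camera.center_mem_curve (hP i)).resolve_right ?_
    -- A nonreal parameter of a real center has the same image as its conjugate, which injectivity
    -- of a smooth quartic excludes.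
    rintro ⟨u, hu, h1, h2⟩
    have hu0 := ne_zero_of_lin_left hu
    have hu1 := ne_zero_of_lin_right hu
    obtain ⟨c, hc⟩ := (P.cam i).exists_smul (hA.1.2 _ hu1) h2 h1
    have hc0 : c ≠ 0 := by
      rintro rfl
      exact hA.1.2 u hu0 (by simpa using hc)
    obtain ⟨d, -, hd⟩ := hA.2.1 u (star u) hu0 hu1 ⟨c, hc0, hc⟩
    apply hu
    nth_rw 1 [hd]
    rw [smul_lin, lin_self, mul_zero]
  refine ⟨1, _, Q, isTwistedCubic_one, ?_, (disjoint_conLine_iff isTwistedCubic_one hnd).2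
    ((isEmbeddedCurve_iff hA.1 hk0 hk).1 hA.2), fun i => companion_center_mem isTwistedCubic_one hnd
      (cx_ne_zero (hw i)) (companion_center hk (hQ i)),
    (companion_conjugateAlong hn hA.1 isTwistedCubic_one hk0 hk hw hQ).1⟩
  rw [IsLine, ← hnd.finrank_conLine]
  exact (Submodule.equivMapOfInjective _ (twistedCubic_injective isTwistedCubic_one) _).symm.finrank_eq

theorem singularQuartic_conjugateAlong {n : ℕ} (hn : 2 ≤ n) {A : Matrix (Fin 4) (Fin (4 + 1)) ℝ}
    (hA : IsSingularRationalQuartic A) {P : CameraTuple n}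
    (hP : ∀ i, ∃ w : Fin 2 → ℝ, w ≠ 0 ∧ (P.cam i).toLin (paramMap A (cx w)) = 0) :
    ∃ (B : Matrix (Fin 4) (Fin (3 + 1)) ℝ) (L : Submodule ℂ (Fin 4 → ℂ)) (Q : CameraTuple n),
      IsTwistedCubic B ∧ IsSecantLine B L ∧ Q.CentersIn (linePoints L) ∧
      Q.AtMostOneCenterIn (curve B) ∧ ConjugateAlong P (curve A) Q (curve B) := by
  obtain ⟨k, hk0, hk⟩ := exists_quartic_ker (A := A)
  have hnd := (isRationalQuartic_iff_nondegenerate hA.1.1 hk0 hk).1 hA.1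
  obtain ⟨Q, w, hw, hQ⟩ := exists_companion_cubic hA.1 hk0 hk hP
  refine ⟨1, _, Q, isTwistedCubic_one, isSecantLine_conLine isTwistedCubic_one hnd
    (not_not.1 fun h => hA.2 ((isEmbeddedCurve_iff hA.1 hk0 hk).2 h)),
    fun i => companion_center_mem isTwistedCubic_one hnd
      (cx_ne_zero (hw i)) (companion_center hk (hQ i)),
    companion_atMostOneCenterIn hA.1 isTwistedCubic_one hk0 hk hw hQ,
    (companion_conjugateAlong hn hA.1 isTwistedCubic_one hk0 hk hw hQ).1⟩

/-! ### A camera center at an isolated real point of a singular quartic -/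

theorem lin_cx_ne_zero {u : Fin 2 → ℂ} (hu : lin u (star u) ≠ 0) {w : Fin 2 → ℝ} (hw : w ≠ 0) :
    lin (cx w) u ≠ 0 := by
  intro h
  obtain ⟨c, rfl⟩ := exists_smul_of_lin_eq_zero (w := u) (cx_ne_zero hw) (by rw [lin_swap, h, neg_zero])
  apply hu
  rw [star_smul, star_cx, lin_smul, smul_lin, lin_self, mul_zero, mul_zero]

theorem lin_star_star_ne_zero {u : Fin 2 → ℂ} (hu : lin u (star u) ≠ 0) :
    lin (star u) (star (star u)) ≠ 0 := by
  rw [star_star]; exact lin_ne_zero_swap hu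

/-- The two parameters have the same image, so some combination of their Veronese vectors is in the
kernel of `A`; neither coefficient vanishes because `k` is not itself a Veronese vector. -/
theorem exists_node_decomposition {A : Matrix (Fin 4) (Fin (4 + 1)) ℝ} (hA : IsRationalQuartic A)
    {k : Fin 5 → ℝ} (hk0 : k ≠ 0) (hk : A.mulVec k = 0) {P : Camera} {u v : Fin 2 → ℂ}
    (huv : lin u v ≠ 0) (hu : P.toLin (paramMap A u) = 0) (hv : P.toLin (paramMap A v) = 0) :
    ∃ α β : ℂ, α ≠ 0 ∧ β ≠ 0 ∧ cx k = α • ver 4 u + β • ver 4 v := by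
  have hnd := (isRationalQuartic_iff_nondegenerate hA.1 hk0 hk).1 hA
  have hu0 := ne_zero_of_lin_left huv
  have hv0 := ne_zero_of_lin_right huv
  obtain ⟨c, hc⟩ := P.exists_smul (hA.2 v hv0) hv hu
  have h1 : (A.map Complex.ofReal).mulVec (ver 4 u - c • ver 4 v) = 0 := by
    rw [Matrix.mulVec_sub, Matrix.mulVec_smul, ← paramMap_eq, ← paramMap_eq, hc, sub_self]
  obtain ⟨d, hd⟩ := rank_four_mulVec_eq_zero hA.1 hk0 hk h1
  have hd0 : d ≠ 0 := by
    rintro rfl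
    rw [zero_smul, sub_eq_add_neg, ← neg_smul] at hd
    exact one_ne_zero (eq_zero_of_smul_ver_add (d := 3) huv
      (a := 1) (b := -c) (by simpa using hd)).1
  have hk' : cx k = d⁻¹ • ver 4 u + (-(d⁻¹ * c)) • ver 4 v := by
    rw [neg_smul, ← sub_eq_add_neg, mul_smul, ← smul_sub, hd, smul_smul, inv_mul_cancel₀ hd0,
      one_smul]
  refine ⟨_, _, inv_ne_zero hd0, fun hb => ?_, hk'⟩
  apply hu0
  apply hnd
  rw [hk', hb, zero_smul, add_zero, con_smul, con_ver, lin_self, zero_smul, smul_zero]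

/-- Only one camera center is an isolated real point. -/
theorem center_eq_of_isolated {A : Matrix (Fin 4) (Fin (4 + 1)) ℝ} (hA : IsRationalQuartic A)
    {P₁ P₂ : Camera} {u v : Fin 2 → ℂ} (hu : lin u (star u) ≠ 0)
    (hu₁ : P₁.toLin (paramMap A u) = 0) (hu₂ : P₁.toLin (paramMap A (star u)) = 0)
    (hv : lin v (star v) ≠ 0) (hv₁ : P₂.toLin (paramMap A v) = 0)
    (hv₂ : P₂.toLin (paramMap A (star v)) = 0) : P₁.center = P₂.center := by
  obtain ⟨k, hk0, hk⟩ := exists_quartic_ker (A := A)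
  obtain ⟨α, β, -, hβ, h⟩ := exists_node_decomposition hA hk0 hk hu hu₁ hu₂
  obtain ⟨γ, δ, -, hδ, h'⟩ := exists_node_decomposition hA hk0 hk hv hv₁ hv₂
  have hv0 := ne_zero_of_lin_right hv
  by_cases hlin : lin (star u) (star v) = 0
  · obtain ⟨c, hc⟩ := exists_smul_of_lin_eq_zero hv0 hlin
    refine Camera.center_eq_of (hA.2 _ (ne_zero_of_lin_right hu)) hu₂ ?_
    rw [hc, paramMap_smul, map_smul, hv₂, smul_zero]
  -- The contractions of `k` at `u` and `v` are the Veronese points of `star u` and `star v`. If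
  -- these differ, commuting contractions force `u ∼ star v`, so the centers agree in this case too.
  · have e1 : con u (cx k) = (β * lin u (star u)) • ver 3 (star u) := by
      rw [h, con_add, con_smul, con_smul, con_ver, con_ver, lin_self, zero_smul, smul_zero,
        zero_add, smul_smul]
    have e2 : con v (cx k) = (δ * lin v (star v)) • ver 3 (star v) := by
      rw [h', con_add, con_smul, con_smul, con_ver, con_ver, lin_self, zero_smul, smul_zero,
        zero_add, smul_smul]
    obtain ⟨e3, -⟩ := eq_ver_add_of_con_of_con (d := 1) hlin (mul_ne_zero hβ hu)
      (mul_ne_zero hδ hv) e1 e2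
    obtain ⟨c, hc⟩ := exists_smul_of_lin_eq_zero hv0 e3
    refine Camera.center_eq_of (hA.2 _ (ne_zero_of_lin_left hu)) hu₁ ?_
    rw [hc, paramMap_smul, map_smul, hv₂, smul_zero]

/-- The image of a quartic under the projection from an isolated real point is a conic. -/
theorem exists_conic_image {A : Matrix (Fin 4) (Fin (4 + 1)) ℝ} (hA : A.rank = 4)
    {P : Camera} {u : Fin 2 → ℂ} (hu : lin u (star u) ≠ 0)
    (hu₁ : P.toLin (paramMap A u) = 0) (hu₂ : P.toLin (paramMap A (star u)) = 0) :
    ∃ N : Matrix (Fin 3) (Fin 3) ℝ, Function.Surjective N.mulVecLin ∧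
      ∀ z, P.toLin (paramMap A z) =
        (lin u z * lin (star u) z) • (N.map Complex.ofReal).mulVec (ver 2 z) := by
  let a : Fin 2 → ℝ := fun i => (u i).re
  let b : Fin 2 → ℝ := fun i => (u i).im
  -- The real form of the contraction at `u` followed by that at `star u`, by `(a + ib)(a - ib) = a²
  -- + b²`.
  let W := shift 2 a * shift 3 a + shift 2 b * shift 3 b
  have hW : ∀ v : Fin 5 → ℂ, (W.map Complex.ofReal).mulVec v = con (star u) (con u v) := by
    intro v
    have h1 : (W.map Complex.ofReal) =
        shift 2 (cx a) * shift 3 (cx a) + shift 2 (cx b) * shift 3 (cx b) := by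
      rw [← shift_map, ← shift_map, ← shift_map, ← shift_map, ← map_ofReal_mul, ← map_ofReal_mul]
      ext i j
      simp [W]
    have hu : u = cx a + Complex.I • cx b := by
      ext i
      simp [cx, a, b, mul_comm Complex.I]
    have hu' : star u = cx a - Complex.I • cx b := by
      rw [hu, star_add, star_smul, star_cx, star_cx]
      simp [sub_eq_add_neg]
    rw [h1, Matrix.add_mulVec, ← Matrix.mulVec_mulVec, ← Matrix.mulVec_mulVec, shift_mulVec,
      shift_mulVec, shift_mulVec, shift_mulVec, hu', hu, sub_con, add_con, con_add, con_add]
    simp only [smul_con, con_smul, smul_smul, Complex.I_mul_I,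
      con_comm (cx a) (cx b)]
    module
  -- The kernel of `W` is spanned by the Veronese vectors of `u` and `star u`, both of which the
  -- camera sends to zero.
  obtain ⟨N, hN⟩ := exists_mul_eq_of_ker_le (P.mat * A) W (by
    intro v hv
    have h1 : con (star u) (con u (cx v)) = 0 := by rw [← hW, ← cx_mulVec, hv, cx_zero]
    obtain ⟨c, hc⟩ := eq_smul_ver_of_con_eq_zero (ne_zero_of_lin_right hu) h1
    obtain ⟨α, β, h⟩ := exists_eq_ver_add hu hc
    apply cx_injective
    rw [← Matrix.mulVec_mulVec, ← Camera.toLin_cx, cx_mulVec, h, Matrix.mulVec_add,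
      Matrix.mulVec_smul, Matrix.mulVec_smul, map_add, map_smul, map_smul, ← paramMap_eq,
      ← paramMap_eq, hu₁, hu₂, smul_zero, smul_zero, add_zero, cx_zero])
  refine ⟨N, surjective_of_mul_eq hN
    (surjective_mul P.surjective ((rank_eq_iff_surjective A).1 hA)), fun z => ?_⟩
  rw [Camera.toLin_apply, paramMap_eq, Matrix.mulVec_mulVec, ← map_ofReal_mul, hN, map_ofReal_mul,
    ← Matrix.mulVec_mulVec, hW, con_ver, con_smul, con_ver, smul_smul, Matrix.mulVec_smul]

/-- The camera at the isolated point is matched with a projection of the cubic from an arbitrary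
real point `t` of it onto the same conic. All other centers are on the real branch and keep their
companions on the chord of `u` and `star u`. -/
theorem isNonTriviallyCritical_of_isolated {n : ℕ} (hn : 2 ≤ n)
    {A : Matrix (Fin 4) (Fin (4 + 1)) ℝ} (hA : IsRationalQuartic A) {P : CameraTuple n}
    (hP : P.CentersIn (curve A)) {i₀ : Fin n} {u : Fin 2 → ℂ} (hu : lin u (star u) ≠ 0)
    (hu₁ : (P.cam i₀).toLin (paramMap A u) = 0)
    (hu₂ : (P.cam i₀).toLin (paramMap A (star u)) = 0) (X : Set P3) (hX : X ⊆ curve A) :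
    IsNonTriviallyCritical P X := by
  obtain ⟨k, hk0, hk⟩ := exists_quartic_ker (A := A)
  have hnd := (isRationalQuartic_iff_nondegenerate hA.1 hk0 hk).1 hA
  obtain ⟨α, β, hα, hβ, hkdec⟩ := exists_node_decomposition hA hk0 hk hu hu₁ hu₂
  obtain ⟨N, hNs, hN⟩ := exists_conic_image hA.1 hu hu₁ hu₂
  have hB := isTwistedCubic_one
  let t : Fin 2 → ℝ := ![1, 0]
  have ht : t ≠ 0 := by simp [t]
  let Q₀ : Camera := Camera.ofSurjective (N * shift 2 t) (surjective_mul hNs (shift_surjective ht))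
  have hQ₀ : ∀ z, Q₀.toLin (paramMap (1 : Matrix (Fin 4) (Fin (3 + 1)) ℝ) z) =
      lin (cx t) z • (N.map Complex.ofReal).mulVec (ver 2 z) := fun z => by
    have h1 : paramMap (1 : Matrix (Fin 4) (Fin (3 + 1)) ℝ) z = ver 3 z := by
      rw [paramMap_eq, Matrix.map_one _ Complex.ofReal_zero Complex.ofReal_one]
      exact Matrix.one_mulVec _
    rw [h1, Camera.toLin_apply]
    change ((N * shift 2 t).map Complex.ofReal).mulVec _ = _
    rw [map_ofReal_mul, shift_map, ← Matrix.mulVec_mulVec, shift_mulVec, con_ver,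
      Matrix.mulVec_smul]
  have hcomp : ∀ j, j ≠ i₀ → ∃ (Q : Camera) (w : Fin 2 → ℝ), w ≠ 0 ∧
      (P.cam j).mat * A = Q.mat * (1 : Matrix (Fin 4) (Fin (3 + 1)) ℝ) * shift 3 w := by
    intro j hj
    rcases Camera.center_mem_curve (hP j) with ⟨w, hw, hPw⟩ | ⟨v, hv, hv₁, hv₂⟩
    · obtain ⟨Q, hQ⟩ := exists_cubic_camera hA.1 hw hPw
      exact ⟨Q, w, hw, by rw [hQ]; exact congrArg (· * _) (Matrix.mul_one _).symm⟩
    · exact absurd (P.distinct (center_eq_of_isolated hA hv hv₁ hv₂ hu hu₁ hu₂)) hj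
  have hex : ∀ j, ∃ Q : Camera, (j = i₀ → Q = Q₀) ∧ (j ≠ i₀ → ∃ w : Fin 2 → ℝ, w ≠ 0 ∧
      (P.cam j).mat * A = Q.mat * (1 : Matrix (Fin 4) (Fin (3 + 1)) ℝ) * shift 3 w) := by
    intro j
    by_cases hj : j = i₀
    · exact ⟨Q₀, fun _ => rfl, fun h => absurd hj h⟩
    · obtain ⟨Q, h⟩ := hcomp j hj
      exact ⟨Q, fun h => absurd h hj, fun _ => h⟩
  choose Q hQ₁ hQ₂ using hex
  -- A companion center has nonzero components at both `u` and `star u`, and the cubic points at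
  -- `u`, `star u`, `t` are independent. This gives both distinct centers and distinct epipoles.
  have hind : ∀ (w : Fin 2 → ℝ), w ≠ 0 → ∀ a b d : ℂ,
      a • paramMap (1 : Matrix (Fin 4) (Fin (3 + 1)) ℝ) u +
        b • paramMap (1 : Matrix (Fin 4) (Fin (3 + 1)) ℝ) (cx t) +
        d • ((1 : Matrix (Fin 4) (Fin (3 + 1)) ℝ).map Complex.ofReal).mulVec
          (con (cx w) (cx k)) = 0 → a = 0 ∧ b = 0 ∧ d = 0 := by
    intro w hw a b d h
    have hw₁ := lin_cx_ne_zero hu hw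
    have hw₂ := lin_cx_ne_zero (lin_star_star_ne_zero hu) hw
    rw [paramMap_eq, paramMap_eq, ← Matrix.mulVec_smul, ← Matrix.mulVec_smul, ← Matrix.mulVec_smul,
      ← Matrix.mulVec_add, ← Matrix.mulVec_add] at h
    have h0 := twistedCubic_injective hB (h.trans (map_zero _).symm)
    rw [hkdec, con_add, con_smul, con_smul, con_ver, con_ver] at h0
    obtain ⟨e1, e2, e3⟩ := eq_zero_of_smul_ver_add_add (d := 1)
      (lin_ne_zero_swap (lin_cx_ne_zero hu ht)) hu (lin_cx_ne_zero (lin_star_star_ne_zero hu) ht)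
      (a := a + d * (α * lin (cx w) u)) (b := b) (c := d * (β * lin (cx w) (star u)))
      (by rw [← h0]; module)
    have hd : d = 0 := by simpa [hβ, hw₂] using e3
    refine ⟨?_, e2, hd⟩
    simpa [hd] using e1
  have hQ₀t : Q₀.toLin (paramMap (1 : Matrix (Fin 4) (Fin (3 + 1)) ℝ) (cx t)) = 0 := by
    rw [hQ₀, lin_self, zero_smul]
  have hpt := twistedCubic_paramMap_ne_zero hB _ (cx_ne_zero ht)
  have hne : ∀ j, j ≠ i₀ → (Q i₀).center ≠ (Q j).center := by
    intro j hj
    obtain ⟨w, hw, h⟩ := hQ₂ j hj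
    rw [hQ₁ i₀ rfl]
    refine Camera.center_ne_of hpt hQ₀t ?_ (companion_center hk h) fun c hc => ?_
    · intro h0
      exact one_ne_zero (hind w hw 0 0 1 (by rw [h0]; simp)).2.2
    · exact one_ne_zero (hind w hw 0 1 (-c) (by rw [hc]; module)).2.1
  let Q' : CameraTuple n := ⟨Q, fun i j hij => by
    by_contra hne'
    by_cases hi : i = i₀
    · subst hi
      exact hne j (fun h => hne' h.symm) hij
    by_cases hj : j = i₀
    · subst hj
      exact hne i hi hij.symm
    obtain ⟨w₁, hw₁, h₁⟩ := hQ₂ i hi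
    obtain ⟨w₂, hw₂, h₂⟩ := hQ₂ j hj
    exact companion_center_ne hB hnd (companion_lin_ne_zero hA (fun e => hne' (P.distinct e))
      hw₁ hw₂ h₁ h₂) (companion_center hk h₁) (companion_center hk h₂) hij⟩
  have hD₀ : ∀ j, j ≠ i₀ → Distinguishable (P.cam i₀) (P.cam j) (Q i₀) (Q j) := by
    intro j hj
    obtain ⟨w, hw, h⟩ := hQ₂ j hj
    obtain ⟨p, hp0, hp⟩ := (P.cam i₀).exists_real_ker
    have hp' : (P.cam i₀).toLin (cx p) = 0 := by rw [Camera.toLin_cx, hp, cx_zero]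
    obtain ⟨c, hc⟩ := (P.cam i₀).exists_smul (cx_ne_zero hp0) hp' hu₁
    have hc0 : c ≠ 0 := by
      rintro rfl
      exact hA.2 u (ne_zero_of_lin_left hu) (by simpa using hc)
    have hw₁ := lin_cx_ne_zero hu hw
    rw [hQ₁ i₀ rfl]
    refine distinguishable_of_epipole (c := cx p)
      -- The node is real but its representative at `u` need not be; the factor `c⁻¹` passes to the
      -- real kernel vector `p`, and `lin (cx w) u` comes from the companion relation.
      (u := (c⁻¹ * lin (cx w) u) • paramMap (1 : Matrix (Fin 4) (Fin (3 + 1)) ℝ) u)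
      (y := (P.cam j).mat.mulVec p) (s := 1) (cx_ne_zero hp0) hp' ?_ ?_ hQ₀t
      (companion_center hk h) ?_
    · rw [one_smul, Camera.toLin_cx]
    · rw [map_smul, mul_smul, ← companion_image h, hc, map_smul, smul_smul, inv_mul_cancel₀ hc0,
        one_smul, Camera.toLin_cx]
    · intro a b d habd
      rw [smul_smul] at habd
      obtain ⟨e1, e2, e3⟩ := hind w hw _ _ _ habd
      exact ⟨by simpa [hc0, hw₁] using e1, e2, e3⟩
  have hD : ∀ i j, i ≠ j → Distinguishable (P.cam i) (P.cam j) (Q'.cam i) (Q'.cam j) := by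
    intro i j hij
    by_cases hi : i = i₀
    · subst hi
      exact hD₀ j hij.symm
    by_cases hj : j = i₀
    · subst hj
      exact (hD₀ i hij).swap
    obtain ⟨w₁, hw₁, h₁⟩ := hQ₂ i hi
    obtain ⟨w₂, hw₂, h₂⟩ := hQ₂ j hj
    exact companion_distinguishable hA hB hk0 hk (fun e => hij (P.distinct e)) hw₁ hw₂ h₁ h₂
  have hI : HaveCommonImages P Q' (fun z : {z : Fin 2 → ℂ // z ≠ 0} => paramMap A z.1)
      (fun z => paramMap (1 : Matrix (Fin 4) (Fin (3 + 1)) ℝ) z.1) := by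
    intro i z
    by_cases hi : i = i₀
    · subst hi
      refine ⟨_, _, lin (cx t) z.1, hN z.1, ?_⟩
      change (Q i).toLin _ = _
      rw [hQ₁ i rfl, hQ₀]
    · obtain ⟨w, hw, h⟩ := hQ₂ i hi
      exact ⟨(Q i).toLin (paramMap 1 z.1), _, 1, companion_image h z.1, (one_smul _ _).symm⟩
  have hconj := hI.conjugateAlong hn (fun z => hA.2 z.1 z.2)
    (fun z => twistedCubic_paramMap_ne_zero hB z.1 z.2) hD
  rw [← curve_eq_range] at hconj
  exact hconj.isNonTriviallyCritical hX

theorem singularQuartic_isNonTriviallyCritical {n : ℕ} (hn : 2 ≤ n)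
    {A : Matrix (Fin 4) (Fin (4 + 1)) ℝ} (hA : IsSingularRationalQuartic A) {P : CameraTuple n}
    (hP : P.CentersIn (curve A)) (X : Set P3) (hX : X ⊆ curve A) : IsNonTriviallyCritical P X := by
  by_cases h : ∀ i, ∃ w : Fin 2 → ℝ, w ≠ 0 ∧ (P.cam i).toLin (paramMap A (cx w)) = 0
  · obtain ⟨B, L, Q, -, -, -, -, hQ⟩ := singularQuartic_conjugateAlong hn hA h
    exact hQ.isNonTriviallyCritical hX
  · rw [not_forall] at h
    obtain ⟨i, hi⟩ := h
    obtain ⟨u, hu, h₁, h₂⟩ := (Camera.center_mem_curve (hP i)).resolve_left hi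
    exact isNonTriviallyCritical_of_isolated hn hA.1 hP hu h₁ h₂ X hX

/-! ### Points on a twisted cubic and cameras on a line -/

theorem exists_matrix_ker {m n : ℕ} (V : Submodule ℝ (Fin n → ℝ))
    (h : Module.finrank ℝ V + m = n) : ∃ G : Matrix (Fin m) (Fin n) ℝ,
      Function.Surjective G.mulVecLin ∧ ∀ v ∈ V, G.mulVec v = 0 := by
  have h1 : Module.finrank ℝ ((Fin n → ℝ) ⧸ V) = Module.finrank ℝ (Fin m → ℝ) := by
    have := V.finrank_quotient_add_finrank
    rw [Module.finrank_fin_fun] at this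
    rw [Module.finrank_fin_fun]
    omega
  let e := LinearEquiv.ofFinrankEq _ _ h1
  have h2 : (LinearMap.toMatrix' (e.toLinearMap.comp V.mkQ)).mulVecLin =
      e.toLinearMap.comp V.mkQ := by
    rw [← Matrix.toLin'_apply', Matrix.toLin'_toMatrix']
  refine ⟨LinearMap.toMatrix' (e.toLinearMap.comp V.mkQ), ?_, fun v hv => ?_⟩
  · rw [h2]
    exact e.surjective.comp V.mkQ_surjective
  · rw [← Matrix.mulVecLin_apply, h2]
    simp [hv]

section Line

variable {n : ℕ} {B : Matrix (Fin 4) (Fin (3 + 1)) ℝ} {L : Submodule ℂ (Fin 4 → ℂ)}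
  {Q : CameraTuple n}

theorem Camera.mem_of_center_mem {Q : Camera} (hQ : Q.center ∈ linePoints L) {v : Fin 4 → ℂ}
    (hv : Q.toLin v = 0) : v ∈ L := by
  by_cases h0 : v = 0
  · rw [h0]; exact L.zero_mem
  · rwa [(Q.center_eq_mk_iff h0).2 hv, mk_mem_linePoints] at hQ

/-- The preimage of the line in the parameter space of the cubic is spanned by real points. -/
theorem exists_real_points_of_line (hn : 2 ≤ n) (hB : IsTwistedCubic B)
    (hQ : Q.CentersIn (linePoints L)) : ∃ p q : Fin 4 → ℝ,
      LinearIndependent ℂ ![cx p, cx q] ∧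
      (B.map Complex.ofReal).mulVec (cx p) ∈ L ∧ (B.map Complex.ofReal).mulVec (cx q) ∈ L := by
  have hBs : Function.Surjective B.mulVecLin := (rank_eq_iff_surjective B).1 hB
  let i : Fin n := ⟨0, by omega⟩
  let j : Fin n := ⟨1, by omega⟩
  have hij : i ≠ j := by simp [i, j]
  obtain ⟨r, hr0, hr⟩ := (Q.cam i).exists_real_ker
  obtain ⟨s, hs0, hs⟩ := (Q.cam j).exists_real_ker
  have hr' : (Q.cam i).toLin (cx r) = 0 := by rw [Camera.toLin_cx, hr, cx_zero]
  have hs' : (Q.cam j).toLin (cx s) = 0 := by rw [Camera.toLin_cx, hs, cx_zero]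
  obtain ⟨p, hp⟩ := hBs r
  obtain ⟨q, hq⟩ := hBs s
  have hp' : (B.map Complex.ofReal).mulVec (cx p) = cx r := by rw [← cx_mulVec, ← hp]; rfl
  have hq' : (B.map Complex.ofReal).mulVec (cx q) = cx s := by rw [← cx_mulVec, ← hq]; rfl
  refine ⟨p, q, ?_, ?_, ?_⟩
  · rw [LinearIndependent.pair_iff]
    intro a b hab
    have h := congrArg (B.map Complex.ofReal).mulVec hab
    rw [Matrix.mulVec_add, Matrix.mulVec_smul, Matrix.mulVec_smul, hp', hq', Matrix.mulVec_zero] at h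
    have hne : (Q.cam i).center ≠ (Q.cam j).center := fun e => hij (Q.distinct e)
    have ha : a = 0 := by
      by_contra ha
      apply hne
      refine Camera.center_eq_of (cx_ne_zero hr0) hr' ?_
      have := congrArg (Q.cam j).toLin h
      rw [map_add, map_smul, map_smul, hs', smul_zero, add_zero, map_zero, smul_eq_zero] at this
      exact this.resolve_left ha
    refine ⟨ha, ?_⟩
    rw [ha, zero_smul, zero_add, smul_eq_zero] at h
    exact h.resolve_right (cx_ne_zero hs0)
  · rw [hp']
    exact Camera.mem_of_center_mem (hQ i) hr'
  · rw [hq']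
    exact Camera.mem_of_center_mem (hQ j) hs'

/-- The kernel of `G` has dimension 2 and contains the independent vectors `p`, `q`, hence is their
span. -/
theorem mem_line_of_mulVec_eq_zero {p q : Fin 4 → ℝ}
    (hpq : LinearIndependent ℂ ![cx p, cx q]) (hp : (B.map Complex.ofReal).mulVec (cx p) ∈ L)
    (hq : (B.map Complex.ofReal).mulVec (cx q) ∈ L) {G : Matrix (Fin 2) (Fin 4) ℝ}
    (hG : Function.Surjective G.mulVecLin) (hGp : G.mulVec p = 0) (hGq : G.mulVec q = 0)
    {v : Fin 4 → ℂ} (hv : (G.map Complex.ofReal).mulVec v = 0) :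
    (B.map Complex.ofReal).mulVec v ∈ L := by
  have h1 := LinearMap.finrank_range_add_finrank_ker (G.map Complex.ofReal).mulVecLin
  have h3 : Module.finrank ℂ (LinearMap.range (G.map Complex.ofReal).mulVecLin) = 2 := by
    rw [LinearMap.range_eq_top.2 (surjective_map_ofReal hG)]
    simp
  rw [h3, Module.finrank_fin_fun] at h1
  have h2 : Submodule.span ℂ (Set.range ![cx p, cx q]) =
      LinearMap.ker (G.map Complex.ofReal).mulVecLin := by
    apply Submodule.eq_of_le_of_finrank_eq
    · rw [Submodule.span_le]
      rintro _ ⟨i, rfl⟩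
      fin_cases i
      · change (G.map Complex.ofReal).mulVec (cx p) = 0
        rw [← cx_mulVec, hGp, cx_zero]
      · change (G.map Complex.ofReal).mulVec (cx q) = 0
        rw [← cx_mulVec, hGq, cx_zero]
    · rw [finrank_span_eq_card hpq, Fintype.card_fin]
      omega
  have h4 : v ∈ Submodule.span ℂ (Set.range ![cx p, cx q]) := by rw [h2]; exact hv
  rw [Matrix.range_cons, Matrix.range_cons, Matrix.range_empty, Set.union_empty,
    Set.singleton_union, Submodule.mem_span_pair] at h4
  obtain ⟨a, b, rfl⟩ := h4
  rw [Matrix.mulVec_add, Matrix.mulVec_smul, Matrix.mulVec_smul]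
  exact add_mem (Submodule.smul_mem _ _ hp) (Submodule.smul_mem _ _ hq)

theorem con_eq_add (x : Fin 2 → ℂ) (k : Fin 5 → ℂ) :
    con x k = x 0 • con ![1, 0] k + x 1 • con ![0, 1] k := by
  rw [← smul_con, ← smul_con, ← add_con]
  congr 1
  ext i
  fin_cases i <;> simp

/-- Every real line is contained in the line of contractions of a dual quartic,
unless it meets the cubic. -/
theorem exists_dual_quartic_of_disjoint (hn : 2 ≤ n) (hB : IsTwistedCubic B)
    (hdisj : Disjoint (linePoints L) (curve B)) (hQ : Q.CentersIn (linePoints L)) :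
    ∃ k : Fin 5 → ℝ, Nondegenerate (cx k) ∧
      ∀ x, (B.map Complex.ofReal).mulVec (con x (cx k)) ∈ L := by
  obtain ⟨p, q, hpq, hp, hq⟩ := exists_real_points_of_line hn hB hQ
  have hpq' : LinearIndependent ℝ ![p, q] := by
    rw [LinearIndependent.pair_iff] at hpq ⊢
    intro a b hab
    have := hpq a b (by
      rw [← cx_zero, ← hab]
      ext i
      simp [cx])
    simpa using this
  obtain ⟨G, hG, hGv⟩ := exists_matrix_ker (m := 2) (Submodule.span ℝ (Set.range ![p, q]))
    (by rw [finrank_span_eq_card hpq', Fintype.card_fin])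
  have hGp : G.mulVec p = 0 := hGv p (Submodule.subset_span ⟨0, rfl⟩)
  have hGq : G.mulVec q = 0 := hGv q (Submodule.subset_span ⟨1, rfl⟩)
  let F : (Fin 5 → ℝ) →ₗ[ℝ] (Fin 2 → ℝ) × (Fin 2 → ℝ) :=
    (G * shift 3 (![1, 0] : Fin 2 → ℝ)).mulVecLin.prod
      (G * shift 3 (![0, 1] : Fin 2 → ℝ)).mulVecLin
  -- Two equations of the line, imposed on the contractions at two basis vectors, are four linear
  -- conditions on five unknowns.
  have hF : LinearMap.ker F ≠ ⊥ := LinearMap.ker_ne_bot_of_finrank_lt (by simp)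
  obtain ⟨k, hk, hk0⟩ := Submodule.exists_mem_ne_zero_of_ne_bot hF
  have hk₁ : G.mulVec (con ![1, 0] k) = 0 := by
    have := congrArg Prod.fst (LinearMap.mem_ker.1 hk)
    rw [← shift_mulVec, Matrix.mulVec_mulVec]
    exact this
  have hk₂ : G.mulVec (con ![0, 1] k) = 0 := by
    have := congrArg Prod.snd (LinearMap.mem_ker.1 hk)
    rw [← shift_mulVec, Matrix.mulVec_mulVec]
    exact this
  have hmem : ∀ x, (B.map Complex.ofReal).mulVec (con x (cx k)) ∈ L := by
    intro x
    apply mem_line_of_mulVec_eq_zero hpq hp hq hG hGp hGq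
    have e₁ : (![1, 0] : Fin 2 → ℂ) = cx ![1, 0] := by ext i; fin_cases i <;> simp [cx]
    have e₂ : (![0, 1] : Fin 2 → ℂ) = cx ![0, 1] := by ext i; fin_cases i <;> simp [cx]
    rw [con_eq_add, e₁, e₂, ← cx_con, ← cx_con, Matrix.mulVec_add, Matrix.mulVec_smul,
      Matrix.mulVec_smul, ← cx_mulVec, ← cx_mulVec, hk₁, hk₂, cx_zero, smul_zero, smul_zero,
      add_zero]
  refine ⟨k, fun x hx => ?_, hmem⟩
  by_contra hx0
  -- A degenerate solution is a Veronese vector at `x`; its other contractions are multiples of the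
  -- cubic point at `x`, which would then be on the line.
  obtain ⟨a, ha⟩ := eq_smul_ver_of_con_eq_zero hx0 hx
  have ha0 : a ≠ 0 := by
    rintro rfl
    exact cx_ne_zero hk0 (by simpa using ha)
  obtain ⟨y, -, hy⟩ := exists_lin_ne_zero hx0
  have h1 := hmem y
  rw [ha, con_smul, con_ver, smul_smul, Matrix.mulVec_smul, ← paramMap_eq] at h1
  have h2 := (Submodule.smul_mem_iff L (mul_ne_zero ha0 (lin_ne_zero_swap hy))).1 h1
  have h3 := twistedCubic_paramMap_ne_zero hB x hx0
  exact Set.disjoint_left.1 hdisj ((mk_mem_linePoints h3).2 h2) ⟨x, hx0, h3, rfl⟩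

theorem line_eq_map_conLine (hB : IsTwistedCubic B) (hL : IsLine L) {k : Fin 5 → ℂ}
    (hnd : Nondegenerate k) (h : ∀ x, (B.map Complex.ofReal).mulVec (con x k) ∈ L) :
    L = (conLine k).map (B.map Complex.ofReal).mulVecLin := by
  symm
  apply Submodule.eq_of_le_of_finrank_eq
  · rintro _ ⟨_, ⟨x, rfl⟩, rfl⟩
    exact h x
  · rw [hL, ← hnd.finrank_conLine]
    exact (Submodule.equivMapOfInjective _ (twistedCubic_injective hB) _).symm.finrank_eq

/-- The center and `k` are real and contraction is injective in the parameter, so the parameter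
equals its conjugate. -/
theorem exists_real_con {k : Fin 5 → ℝ} (hB : IsTwistedCubic B) (hnd : Nondegenerate (cx k))
    {Q : Camera} (hQ : Q.center ∈ linePoints ((conLine (cx k)).map (B.map Complex.ofReal).mulVecLin)) :
    ∃ w : Fin 2 → ℝ, w ≠ 0 ∧ (Q.mat * B).mulVec (con w k) = 0 := by
  obtain ⟨r, hr0, hr⟩ := Q.exists_real_ker
  have hr' : Q.toLin (cx r) = 0 := by rw [Camera.toLin_cx, hr, cx_zero]
  obtain ⟨_, ⟨x, rfl⟩, hx⟩ := Camera.mem_of_center_mem hQ hr'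
  rw [Matrix.mulVecLin_apply, conMap_apply] at hx
  have hx0 : x ≠ 0 := by
    rintro rfl
    rw [zero_con, Matrix.mulVec_zero] at hx
    exact cx_ne_zero hr0 hx.symm
  have h1 : con (star x) (cx k) = con x (cx k) := by
    apply twistedCubic_injective hB
    rw [Matrix.mulVecLin_apply, Matrix.mulVecLin_apply, hx, ← star_cx k, ← star_con,
      ← star_map_mulVec, hx, star_cx]
  have h2 := hnd (star x - x) (by rw [sub_con, h1, sub_self])
  obtain ⟨w, rfl⟩ := eq_cx_of_star_eq (sub_eq_zero.1 h2)
  refine ⟨w, fun h => hx0 (by rw [h, cx_zero]), ?_⟩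
  apply cx_injective
  rw [← Matrix.mulVec_mulVec, ← Camera.toLin_cx, cx_mulVec, cx_con, hx, hr', cx_zero]

/-- Any `A` with kernel spanned by `k` serves. The bound on centers on the cubic is what keeps the
new centers distinct: cameras at parameters `w i` and `w j` share a center only if `k` is on their
chord, and then both old centers are on the cubic. -/
theorem exists_companion_quartic {k : Fin 5 → ℝ} (hB : IsTwistedCubic B)
    (hnd : Nondegenerate (cx k))
    (hQ : Q.CentersIn (linePoints ((conLine (cx k)).map (B.map Complex.ofReal).mulVecLin)))
    (hone : Q.AtMostOneCenterIn (curve B)) :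
    ∃ (A : Matrix (Fin 4) (Fin (4 + 1)) ℝ) (P : CameraTuple n) (w : Fin n → Fin 2 → ℝ),
      IsRationalQuartic A ∧ A.mulVec k = 0 ∧ (∀ i, w i ≠ 0) ∧
      ∀ i, (P.cam i).mat * A = (Q.cam i).mat * B * shift 3 (w i) := by
  have hk0 : k ≠ 0 := by
    rintro rfl
    have := hnd ![1, 0] (by rw [cx_zero, con_zero])
    simp at this
  obtain ⟨A, hAs, hAk⟩ := exists_matrix_ker (m := 4) (Submodule.span ℝ {k})
    (by rw [finrank_span_singleton hk0])
  have hk := hAk k (Submodule.mem_span_singleton_self k)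
  have hA4 : A.rank = 4 := (rank_eq_iff_surjective A).2 hAs
  have hA := (isRationalQuartic_iff_nondegenerate hA4 hk0 hk).2 hnd
  choose w hw hQw using fun i => exists_real_con hB hnd (hQ i)
  choose P hP using fun i => exists_quartic_camera hA4 hk0 hk hB (hw i) (hQw i)
  refine ⟨A, ⟨P, fun i j hij => ?_⟩, w, hA, hk, hw, hP⟩
  by_contra hne
  have hlin : lin (cx (w i)) (cx (w j)) ≠ 0 := by
    intro h
    obtain ⟨c, hc⟩ := exists_smul_of_lin_eq_zero (cx_ne_zero (hw j)) h
    have hc0 : c ≠ 0 := by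
      rintro rfl
      exact cx_ne_zero (hw i) (by simpa using hc)
    have h1 := companion_center hk (hP i)
    rw [hc, smul_con, Matrix.mulVec_smul, map_smul, smul_eq_zero] at h1
    refine hne (Q.distinct (Camera.center_eq_of (fun h0 => ?_) (h1.resolve_left hc0)
      (companion_center hk (hP j))))
    exact cx_ne_zero (hw j) (hnd _ (twistedCubic_injective hB (h0.trans (map_zero _).symm)))
  have hwi := hA.2 _ (cx_ne_zero (hw i))
  have hcen := (Camera.center_eq_mk_iff (P i) hwi).2 (companion_center_left (hP i))
  have h1 : (P j).toLin (paramMap A (cx (w i))) = 0 :=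
    ((P j).center_eq_mk_iff hwi).1 (hij.symm.trans hcen)
  obtain ⟨α, β, hα, hβ, h⟩ := exists_node_decomposition hA hk0 hk hlin h1
    (companion_center_left (hP j))
  have key : ∀ {Q : Camera} {v : Fin 2 → ℂ} {a : ℂ}, a ≠ 0 → v ≠ 0 →
      Q.toLin ((B.map Complex.ofReal).mulVec (a • ver 3 v)) = 0 → Q.center ∈ curve B := by
    intro Q v a ha hv h
    rw [Matrix.mulVec_smul, map_smul, smul_eq_zero] at h
    have hv' := twistedCubic_paramMap_ne_zero hB v hv
    exact ⟨v, hv, hv', (Q.center_eq_mk_iff hv').2 (h.resolve_left ha)⟩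
  apply hne
  apply hone
  · have h2 := companion_center hk (hP i)
    rw [h, con_add, con_smul, con_smul, con_ver, con_ver, lin_self, zero_smul, smul_zero, zero_add,
      smul_smul] at h2
    exact key (mul_ne_zero hβ hlin) (cx_ne_zero (hw j)) h2
  · have h2 := companion_center hk (hP j)
    rw [h, con_add, con_smul, con_smul, con_ver, con_ver, lin_self, zero_smul, smul_zero, add_zero,
      smul_smul] at h2
    exact key (mul_ne_zero hα (lin_ne_zero_swap hlin)) (cx_ne_zero (hw i)) h2

theorem companion_centersIn_realBranch {A : Matrix (Fin 4) (Fin (4 + 1)) ℝ}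
    (hA : IsRationalQuartic A) {P : CameraTuple n} {w : Fin n → Fin 2 → ℝ} (hw : ∀ i, w i ≠ 0)
    (h : ∀ i, (P.cam i).mat * A = (Q.cam i).mat * B * shift 3 (w i)) :
    P.CentersIn (realBranch A) := fun i => by
  have hwi := hA.2 _ (cx_ne_zero (hw i))
  exact ⟨w i, hw i, hwi, ((P.cam i).center_eq_mk_iff hwi).2 (companion_center_left (h i))⟩

theorem realBranch_subset_curve {d : ℕ} (A : Matrix (Fin 4) (Fin (d + 1)) ℝ) :
    realBranch A ⊆ curve A := by
  rintro _ ⟨w, hw, hw', rfl⟩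
  exact ⟨_, cx_ne_zero hw, hw', rfl⟩

theorem disjointLine_conjugateAlong (hn : 2 ≤ n) (hB : IsTwistedCubic B) (hL : IsLine L)
    (hdisj : Disjoint (linePoints L) (curve B)) (hQ : Q.CentersIn (linePoints L)) :
    ∃ (A : Matrix (Fin 4) (Fin (4 + 1)) ℝ) (P : CameraTuple n),
      IsSmoothRationalQuartic A ∧ P.CentersIn (curve A) ∧
      ConjugateAlong Q (curve B) P (curve A) := by
  obtain ⟨k, hnd, hk⟩ := exists_dual_quartic_of_disjoint hn hB hdisj hQ
  obtain rfl := line_eq_map_conLine hB hL hnd hk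
  obtain ⟨A, P, w, hA, hAk, hw, h⟩ := exists_companion_quartic hB hnd hQ
    fun i j hi _ => absurd hi (Set.disjoint_left.1 hdisj (hQ i))
  have hk0 : k ≠ 0 := by
    rintro rfl
    have := hnd ![1, 0] (by rw [cx_zero, con_zero])
    simp at this
  exact ⟨A, P, ⟨hA, (isEmbeddedCurve_iff hA hk0 hAk).2 ((disjoint_conLine_iff hB hnd).1 hdisj)⟩,
    fun i => realBranch_subset_curve A (companion_centersIn_realBranch hA hw h i),
    (companion_conjugateAlong hn hA hB hk0 hAk hw h).2⟩

end Line

/-! ### Cameras on a secant line of a twisted cubic -/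

/-- The matrix of the contraction of dual cubics with a real quadratic form. -/
def quadricMat (q : Fin 3 → ℝ) : Matrix (Fin 2) (Fin 4) ℝ :=
  !![q 0, q 1, q 2, 0; 0, q 0, q 1, q 2]

theorem quadricMat_surjective {q : Fin 3 → ℝ} (hq : q ≠ 0) :
    Function.Surjective (quadricMat q).mulVecLin := by
  intro y
  by_cases h2 : q 2 = 0
  · by_cases h0 : q 0 = 0
    · have h1 : q 1 ≠ 0 := fun h1 => hq (by ext i; fin_cases i <;> simpa)
      refine ⟨![0, y 0 / q 1, y 1 / q 1, 0], ?_⟩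
      ext i
      fin_cases i <;> simp [quadricMat, Matrix.mulVec, dotProduct, Fin.sum_univ_succ, h0, h2] <;>
        field_simp
    · refine ⟨![(y 0 - q 1 * (y 1 / q 0)) / q 0, y 1 / q 0, 0, 0], ?_⟩
      ext i
      fin_cases i <;> simp [quadricMat, Matrix.mulVec, dotProduct, Fin.sum_univ_succ] <;>
        field_simp
      ring
  · refine ⟨![0, 0, y 0 / q 2, (y 1 - q 1 * (y 0 / q 2)) / q 2], ?_⟩
    ext i
    fin_cases i <;> simp [quadricMat, Matrix.mulVec, dotProduct, Fin.sum_univ_succ] <;>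
      field_simp
    ring

/-- A real quadric contracts some nondegenerate dual quartic to zero. -/
theorem exists_nondegenerate_of_quadric (q : Fin 3 → ℝ) :
    ∃ k : Fin 5 → ℝ, Nondegenerate (cx k) ∧
      ∀ i : Fin 3, q 0 * k i.castSucc.castSucc + q 1 * k i.castSucc.succ + q 2 * k i.succ.succ = 0 := by
  by_cases h2 : q 2 = 0
  · by_cases h0 : q 0 = 0
    -- Only `q 1` survives, so the equations say that the three middle entries vanish.
    · refine ⟨![1, 0, 0, 0, 1], fun x hx => ?_, fun i => ?_⟩
      · have e0 := congrFun hx 0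
        have e3 := congrFun hx 3
        simp [con, cx] at e0 e3
        ext i; fin_cases i
        · exact e0
        · simpa [Fin.succ] using e3
      · fin_cases i <;> simp [h0, h2]
    -- The recursion is solved downwards from the entries `1, 0` in positions 3 and 4. This pair
    -- forces nondegeneracy, as does `0, 1` in positions 0 and 1 for the upward recursion when `q 2`
    -- is nonzero.
    · let k₂ := -(q 1) / q 0
      let k₁ := -(q 1 * k₂ + q 2) / q 0
      let k₀ := -(q 1 * k₁ + q 2 * k₂) / q 0
      refine ⟨![k₀, k₁, k₂, 1, 0], fun x hx => ?_, fun i => ?_⟩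
      · have e3 := congrFun hx 3
        have e2 := congrFun hx 2
        simp [con, cx, Fin.succ] at e2 e3
        rw [e3] at e2
        ext i; fin_cases i
        · exact e3
        · simpa using e2
      · fin_cases i <;> simp [Fin.succ, k₀, k₁, k₂] <;> field_simp <;> ring
  · let k₂ := -(q 1) / q 2
    let k₃ := -(q 0 + q 1 * k₂) / q 2
    let k₄ := -(q 0 * k₂ + q 1 * k₃) / q 2
    refine ⟨![0, 1, k₂, k₃, k₄], fun x hx => ?_, fun i => ?_⟩
    · have e0 := congrFun hx 0
      have e1 := congrFun hx 1
      simp [con, cx, Fin.succ] at e0 e1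
      rw [e0] at e1
      ext i; fin_cases i
      · simpa using e1
      · exact e0
    · fin_cases i <;> simp [Fin.succ, k₂, k₃, k₄] <;> field_simp <;> ring

/-- A product of two linear forms annihilating two real points has a real analogue. -/
theorem exists_real_quadric {z w : Fin 2 → ℂ} (hz : z ≠ 0) (hw : w ≠ 0) :
    ∃ q : Fin 3 → ℝ, q ≠ 0 ∧
      ∀ p : Fin 4 → ℝ, con z (con w (cx p)) = 0 → (quadricMat q).mulVec p = 0 := by
  -- The coefficients of the product of the two linear forms. On real vectors its real and imaginary
  -- parts annihilate separately, and one of them is nonzero.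
  let Q : Fin 3 → ℂ := ![z 0 * w 0, -(z 1 * w 0 + z 0 * w 1), z 1 * w 1]
  have hQ : Q ≠ 0 := by
    intro h
    have h0 := congrFun h 0
    have h1 := congrFun h 1
    have h2 := congrFun h 2
    simp [Q, -neg_add_rev] at h0 h1 h2
    by_cases hz0 : z 0 = 0
    · have hz1 : z 1 ≠ 0 := fun h1 => hz (by ext i; fin_cases i <;> simpa)
      apply hw
      ext i
      fin_cases i
      · simpa [hz0, hz1] using h1
      · simpa [hz1] using h2
    · apply hw
      have hw0 : w 0 = 0 := h0.resolve_left hz0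
      ext i
      fin_cases i
      · exact hw0
      · simpa [hz0, hw0] using h1
  have hcon : ∀ p : Fin 4 → ℝ, con z (con w (cx p)) = 0 → ∀ i : Fin 2,
      Q 0 * p i.castSucc.castSucc + Q 1 * p i.castSucc.succ + Q 2 * p i.succ.succ = 0 := by
    intro p hp i
    have := congrFun hp i
    simp only [con, cx, Pi.zero_apply, Fin.succ_castSucc] at this
    simp only [Q, Matrix.cons_val_zero, Matrix.cons_val_one, Matrix.cons_val, Fin.succ_castSucc]
    linear_combination this
  have hre : ∀ p : Fin 4 → ℝ, con z (con w (cx p)) = 0 →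
      (quadricMat fun i => (Q i).re).mulVec p = 0 := by
    intro p hp
    have e0 := congrArg Complex.re (hcon p hp 0)
    have e1 := congrArg Complex.re (hcon p hp 1)
    simp only [Complex.add_re, Complex.re_mul_ofReal, Complex.zero_re] at e0 e1
    ext i
    fin_cases i <;> simp [quadricMat, Matrix.mulVec, dotProduct, Fin.sum_univ_succ]
    · simp [Fin.succ] at e0; linear_combination e0
    · simp [Fin.succ] at e1; linear_combination e1
  have him : ∀ p : Fin 4 → ℝ, con z (con w (cx p)) = 0 →
      (quadricMat fun i => (Q i).im).mulVec p = 0 := by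
    intro p hp
    have e0 := congrArg Complex.im (hcon p hp 0)
    have e1 := congrArg Complex.im (hcon p hp 1)
    simp only [Complex.add_im, Complex.im_mul_ofReal, Complex.zero_im] at e0 e1
    ext i
    fin_cases i <;> simp [quadricMat, Matrix.mulVec, dotProduct, Fin.sum_univ_succ]
    · simp [Fin.succ] at e0; linear_combination e0
    · simp [Fin.succ] at e1; linear_combination e1
  by_cases h : (fun i => (Q i).re) = 0
  · refine ⟨_, fun h' => hQ ?_, him⟩
    ext i
    exact Complex.ext (congrFun h i) (congrFun h' i)
  · exact ⟨_, h, hre⟩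

section Secant

variable {n : ℕ} {B : Matrix (Fin 4) (Fin (3 + 1)) ℝ} {L : Submodule ℂ (Fin 4 → ℂ)}
  {Q : CameraTuple n}

/-- The quadric of the two points of contact annihilates `L`, and a real version `q` still does
because `L` has two real points. If `q` annihilates `k`, it annihilates all contractions of `k`, so
these lie on `L`. -/
theorem exists_dual_quartic_of_secant (hn : 2 ≤ n) (hB : IsTwistedCubic B) (hL : IsSecantLine B L)
    (hQ : Q.CentersIn (linePoints L)) :
    ∃ k : Fin 5 → ℝ, Nondegenerate (cx k) ∧ OnSecantVariety (cx k) ∧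
      ∀ x, (B.map Complex.ofReal).mulVec (con x (cx k)) ∈ L := by
  obtain ⟨z, w, hz, hw, hzw⟩ := hL.exists_con_con_eq_zero hB
  obtain ⟨q, hq0, hq⟩ := exists_real_quadric hz hw
  obtain ⟨k, hnd, hk⟩ := exists_nondegenerate_of_quadric q
  obtain ⟨p₁, p₂, hind, hp₁, hp₂⟩ := exists_real_points_of_line hn hB hQ
  have hmem : ∀ x, (B.map Complex.ofReal).mulVec (con x (cx k)) ∈ L := by
    intro x
    refine mem_line_of_mulVec_eq_zero hind hp₁ hp₂ (quadricMat_surjective hq0)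
      (hq p₁ (hzw _ hp₁)) (hq p₂ (hzw _ hp₂)) ?_
    have hkc := fun i => congrArg Complex.ofReal (hk i)
    have e0 := hkc 0
    have e1 := hkc 1
    have e2 := hkc 2
    simp [Fin.succ] at e0 e1 e2
    ext i
    fin_cases i <;>
      simp [quadricMat, Matrix.mulVec, dotProduct, Fin.sum_univ_succ, con, cx, Fin.succ]
    · linear_combination x 1 * e1 - x 0 * e0
    · linear_combination x 1 * e2 - x 0 * e1
  refine ⟨k, hnd, ⟨z, w, hz, hw, ?_⟩, hmem⟩
  -- The original quadric `z`, `w` kills all contractions of `k`. Contractions commute, so `con z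
  -- (con w (cx k))` has only zero contractions and must itself vanish.
  have h1 : ∀ x, con x (con z (con w (cx k))) = 0 := fun x => by
    rw [con_comm x z, con_comm x w]
    exact hzw _ (hmem x)
  have h2 := h1 ![1, 0]
  have h3 := h1 ![0, 1]
  ext i
  fin_cases i
  · have := congrFun h2 0
    simp [con] at this ⊢
    linear_combination -this
  · have := congrFun h2 1
    simp [con] at this ⊢
    linear_combination -this
  · simpa [con] using congrFun h3 1

theorem secantLine_conjugateAlong (hn : 2 ≤ n) (hB : IsTwistedCubic B) (hL : IsSecantLine B L)
    (hQ : Q.CentersIn (linePoints L)) (hone : Q.AtMostOneCenterIn (curve B)) :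
    ∃ (A : Matrix (Fin 4) (Fin (4 + 1)) ℝ) (P : CameraTuple n),
      IsSingularRationalQuartic A ∧ P.CentersIn (realBranch A) ∧
      ConjugateAlong Q (curve B) P (curve A) := by
  obtain ⟨k, hnd, hsec, hk⟩ := exists_dual_quartic_of_secant hn hB hL hQ
  obtain rfl := line_eq_map_conLine hB hL.1 hnd hk
  obtain ⟨A, P, w, hA, hAk, hw, h⟩ := exists_companion_quartic hB hnd hQ hone
  have hk0 : k ≠ 0 := by
    rintro rfl
    have := hnd ![1, 0] (by rw [cx_zero, con_zero])
    simp at this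
  exact ⟨A, P, ⟨hA, fun he => (isEmbeddedCurve_iff hA hk0 hAk).1 he hsec⟩,
    companion_centersIn_realBranch hA hw h, (companion_conjugateAlong hn hA hB hk0 hAk hw h).2⟩

/-! ### Two camera centers on the cubic -/

theorem exists_real_of_center_mem_cubic (hB : IsTwistedCubic B) {Q : Camera}
    (hQ : Q.center ∈ curve B) :
    ∃ w : Fin 2 → ℝ, w ≠ 0 ∧ Q.toLin (paramMap B (cx w)) = 0 := by
  refine (Camera.center_mem_curve hQ).resolve_right ?_
  rintro ⟨u, hu, h₁, h₂⟩
  obtain ⟨c, hc⟩ := Q.exists_smul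
    (twistedCubic_paramMap_ne_zero hB _ (ne_zero_of_lin_right hu)) h₂ h₁
  rw [paramMap_eq, paramMap_eq, ← Matrix.mulVec_smul] at hc
  have h := twistedCubic_injective hB hc
  exact one_ne_zero (eq_zero_of_smul_ver_add (d := 2) hu (a := 1) (b := -c) (by rw [h]; module)).1

theorem conic_image {Q : Camera} {N : Matrix (Fin 3) (Fin 3) ℝ} {u : Fin 2 → ℝ}
    (h : Q.mat * B = N * shift 2 u) (z : Fin 2 → ℂ) :
    Q.toLin (paramMap B z) = lin (cx u) z • (N.map Complex.ofReal).mulVec (ver 2 z) := by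
  rw [Camera.toLin_apply, paramMap_eq, Matrix.mulVec_mulVec, ← map_ofReal_mul, h, map_ofReal_mul,
    shift_map, ← Matrix.mulVec_mulVec, shift_mulVec, con_ver, Matrix.mulVec_smul]

/-- The conic image of a cubic under the projection from one of its points is also its image
under a projection from any other one. -/
theorem exists_reprojection (hB : IsTwistedCubic B) {Q : Camera} {u : Fin 2 → ℝ} (hu : u ≠ 0)
    (hQ : Q.toLin (paramMap B (cx u)) = 0) {t : Fin 2 → ℝ} (ht : t ≠ 0) :
    ∃ (N : Matrix (Fin 3) (Fin 3) ℝ) (P : Camera),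
      Q.mat * B = N * shift 2 u ∧ P.mat * B = N * shift 2 t := by
  have hBs : Function.Surjective B.mulVecLin := (rank_eq_iff_surjective B).1 hB
  obtain ⟨N, hN⟩ := exists_mul_eq_of_ker_le (Q.mat * B) (shift 2 u) (by
    intro v hv
    rw [shift_mulVec] at hv
    obtain ⟨a, rfl⟩ := eq_smul_ver_of_con_eq_zero hu hv
    rw [paramMap_cx, Camera.toLin_cx, ← cx_zero] at hQ
    rw [Matrix.mulVec_smul, ← Matrix.mulVec_mulVec, cx_injective hQ, smul_zero])
  have hNs := surjective_of_mul_eq hN (surjective_mul Q.surjective hBs)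
  obtain ⟨T, hT⟩ := exists_mul_eq_of_ker_le (N * shift 2 t) B (by
    intro v hv
    have : v = 0 := LinearMap.injective_iff_surjective.2 hBs (hv.trans (map_zero _).symm)
    rw [this, Matrix.mulVec_zero])
  exact ⟨N, Camera.ofSurjective T (surjective_of_mul_eq hT
    (surjective_mul hNs (shift_surjective ht))), hN, hT.symm⟩

theorem eq_zero_of_smul_paramMap_add (hB : IsTwistedCubic B) {z w y : Fin 2 → ℂ}
    (h : lin z w ≠ 0) (h' : lin z y ≠ 0) (h'' : lin w y ≠ 0) {a b c : ℂ}
    (hab : a • paramMap B z + b • paramMap B w + c • paramMap B y = 0) :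
    a = 0 ∧ b = 0 ∧ c = 0 := by
  rw [paramMap_eq, paramMap_eq, paramMap_eq, ← Matrix.mulVec_smul, ← Matrix.mulVec_smul,
    ← Matrix.mulVec_smul, ← Matrix.mulVec_add, ← Matrix.mulVec_add] at hab
  exact eq_zero_of_smul_ver_add_add (d := 1) h h' h''
    (twistedCubic_injective hB (hab.trans (map_zero _).symm))

/-- The center of `Q₁` is the cubic point at `u`, which the unchanged `Q₂` still sees at the old
epipole. The new base line joins the cubic point at `t` to a point of the chord other than `u`, so
it misses `u`. -/
theorem reprojection_distinguishable (hB : IsTwistedCubic B) {Q₁ P₁ Q₂ : Camera}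
    {u v t : Fin 2 → ℝ} (huv : lin (cx u) (cx v) ≠ 0) (hut : lin (cx u) (cx t) ≠ 0)
    (hvt : lin (cx v) (cx t) ≠ 0) (hQ₁ : Q₁.toLin (paramMap B (cx u)) = 0)
    (hP₁ : P₁.toLin (paramMap B (cx t)) = 0) {a b : ℂ} (hb : b ≠ 0)
    (hQ₂ : Q₂.toLin (a • paramMap B (cx u) + b • paramMap B (cx v)) = 0) :
    Distinguishable Q₁ Q₂ P₁ Q₂ ∧ P₁.center ≠ Q₂.center := by
  have hind : ∀ α β γ : ℂ, α • paramMap B (cx u) + β • paramMap B (cx t) +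
      γ • (a • paramMap B (cx u) + b • paramMap B (cx v)) = 0 → α = 0 ∧ β = 0 ∧ γ = 0 := by
    intro α β γ h
    obtain ⟨e1, e2, e3⟩ := eq_zero_of_smul_paramMap_add hB hut huv (lin_ne_zero_swap hvt)
      (a := α + γ * a) (b := β) (c := γ * b) (by rw [← h]; module)
    have hc : γ = 0 := by simpa [hb] using e3
    exact ⟨by simpa [hc] using e1, e2, hc⟩
  constructor
  · refine distinguishable_of_epipole (c := paramMap B (cx u)) (u := paramMap B (cx u))
      (y := Q₂.mat.mulVec (B.mulVec (ver 3 u))) (s := 1)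
      (twistedCubic_paramMap_ne_zero hB _ (ne_zero_of_lin_left huv)) hQ₁ ?_ ?_ hP₁ hQ₂ hind
    · rw [one_smul, ← Camera.toLin_cx, ← paramMap_cx]
    · rw [← Camera.toLin_cx, ← paramMap_cx]
  · refine Camera.center_ne_of (twistedCubic_paramMap_ne_zero hB _ (ne_zero_of_lin_right hut))
      hP₁ (fun h0 => ?_) hQ₂ fun c hc => ?_
    · exact one_ne_zero (hind 0 0 1 (by rw [h0]; simp)).2.2
    · exact one_ne_zero (hind 0 1 (-c) (by rw [hc]; module)).2.1

/-- With both cameras moved, the second still sees the cubic point at `u` at its old place on the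
conic, and this point is off the new base line through the points at `t` and `s`. -/
theorem reprojection_pair (hB : IsTwistedCubic B) {Q₁ P₁ Q₂ P₂ : Camera}
    {N : Matrix (Fin 3) (Fin 3) ℝ} {u v t s : Fin 2 → ℝ}
    (hut : lin (cx u) (cx t) ≠ 0) (hus : lin (cx u) (cx s) ≠ 0) (hts : lin (cx t) (cx s) ≠ 0)
    (hQ₁ : Q₁.toLin (paramMap B (cx u)) = 0) (hP₁ : P₁.toLin (paramMap B (cx t)) = 0)
    (hQ₂ : Q₂.mat * B = N * shift 2 v) (hP₂ : P₂.mat * B = N * shift 2 s) :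
    Distinguishable Q₁ Q₂ P₁ P₂ ∧ P₁.center ≠ P₂.center := by
  have hP₂s : P₂.toLin (paramMap B (cx s)) = 0 := by rw [conic_image hP₂, lin_self, zero_smul]
  have ht := twistedCubic_paramMap_ne_zero hB _ (ne_zero_of_lin_right hut)
  have hs := twistedCubic_paramMap_ne_zero hB _ (ne_zero_of_lin_right hus)
  have hsu := lin_ne_zero_swap hus
  constructor
  · refine distinguishable_of_epipole (c := paramMap B (cx u))
      (u := (lin (cx s) (cx u))⁻¹ • paramMap B (cx u))
      (y := N.mulVec (ver 2 u)) (s := lin (cx v) (cx u))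
      (twistedCubic_paramMap_ne_zero hB _ (ne_zero_of_lin_left hut)) hQ₁ ?_ ?_ hP₁ hP₂s ?_
    · rw [conic_image hQ₂, cx_mulVec, cx_ver]
    · rw [map_smul, conic_image hP₂, cx_mulVec, cx_ver, smul_smul, inv_mul_cancel₀ hsu, one_smul]
    · intro a b d h
      rw [smul_smul] at h
      obtain ⟨e1, e2, e3⟩ := eq_zero_of_smul_paramMap_add hB hut hus hts h
      exact ⟨by simpa [hsu] using e1, e2, e3⟩
  · refine Camera.center_ne_of ht hP₁ hs hP₂s fun c hc => ?_
    exact one_ne_zero (eq_zero_of_smul_paramMap_add hB hut hus hts (a := 0) (b := 1) (c := -c)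
      (by rw [hc]; module)).2.1

/-- Moving two camera centers along the cubic. -/
theorem exists_reprojected_cameras (hB : IsTwistedCubic B) (hL : IsLine L)
    (hQ : Q.CentersIn (linePoints L)) {i j : Fin n} (hij : i ≠ j)
    (hi : (Q.cam i).center ∈ curve B) (hj : (Q.cam j).center ∈ curve B) :
    ∃ P : CameraTuple n,
      HaveCommonImages Q P (fun z : {z : Fin 2 → ℂ // z ≠ 0} => paramMap B z.1)
        (fun z => paramMap B z.1) ∧
      ∀ a b, a ≠ b → (a = i ∨ a = j ∨ b = i ∨ b = j) →
        Distinguishable (Q.cam a) (Q.cam b) (P.cam a) (P.cam b) := by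
  obtain ⟨u, hu, hQu⟩ := exists_real_of_center_mem_cubic hB hi
  obtain ⟨v, hv, hQv⟩ := exists_real_of_center_mem_cubic hB hj
  have hu' := twistedCubic_paramMap_ne_zero hB _ (cx_ne_zero hu)
  have hv' := twistedCubic_paramMap_ne_zero hB _ (cx_ne_zero hv)
  have huv : lin (cx u) (cx v) ≠ 0 := by
    intro h
    obtain ⟨c, hc⟩ := exists_smul_of_lin_eq_zero (cx_ne_zero hv) h
    refine hij (Q.distinct (Camera.center_eq_of hu' hQu ?_))
    rw [hc, paramMap_smul, map_smul, hQv, smul_zero]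
  have hvu := lin_ne_zero_swap huv
  -- The moved centers get the parameters `u + v` and `u - v`, which are real and distinct from `u`,
  -- `v` and each other.
  have hct : cx (u + v) = cx u + cx v := by ext i; simp [cx]
  have hcs : cx (u - v) = cx u - cx v := by ext i; simp [cx]
  have hut : lin (cx u) (cx (u + v)) ≠ 0 := by
    rw [hct, lin_add, lin_self, zero_add]; exact huv
  have hvt : lin (cx v) (cx (u + v)) ≠ 0 := by
    rw [hct, lin_add, lin_self, add_zero]; exact hvu
  have hus : lin (cx u) (cx (u - v)) ≠ 0 := by
    rw [hcs, lin_sub, lin_self, zero_sub]; exact neg_ne_zero.2 huv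
  have hvs : lin (cx v) (cx (u - v)) ≠ 0 := by
    rw [hcs, lin_sub, lin_self, sub_zero]; exact hvu
  have hts : lin (cx (u + v)) (cx (u - v)) ≠ 0 := by
    have : lin (cx (u + v)) (cx (u - v)) = 2 * lin (cx v) (cx u) := by
      rw [hct, hcs]; simp only [lin, Pi.add_apply, Pi.sub_apply]; ring
    rw [this]
    exact mul_ne_zero two_ne_zero hvu
  have ht : u + v ≠ 0 := fun h => by rw [h, cx_zero] at hut; simp [lin] at hut
  have hs : u - v ≠ 0 := fun h => by rw [h, cx_zero] at hus; simp [lin] at hus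
  obtain ⟨N₁, P₁, hN₁, hP₁⟩ := exists_reprojection hB hu hQu ht
  obtain ⟨N₂, P₂, hN₂, hP₂⟩ := exists_reprojection hB hv hQv hs
  have hP₁t : P₁.toLin (paramMap B (cx (u + v))) = 0 := by
    rw [conic_image hP₁, lin_self, zero_smul]
  have hP₂s : P₂.toLin (paramMap B (cx (u - v))) = 0 := by
    rw [conic_image hP₂, lin_self, zero_smul]
  have hLspan : Submodule.span ℂ (Set.range ![paramMap B (cx u), paramMap B (cx v)]) = L := by
    apply Submodule.eq_of_le_of_finrank_eq
    · rw [Submodule.span_le]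
      rintro _ ⟨l, rfl⟩
      fin_cases l
      · exact Camera.mem_of_center_mem (hQ i) hQu
      · exact Camera.mem_of_center_mem (hQ j) hQv
    · rw [finrank_span_eq_card, Fintype.card_fin, hL]
      rw [LinearIndependent.pair_iff]
      intro a b hab
      obtain ⟨e1, e2, -⟩ := eq_zero_of_smul_paramMap_add hB huv hut hvt (a := a) (b := b) (c := 0)
        (by rw [zero_smul, add_zero]; exact hab)
      exact ⟨e1, e2⟩
  -- `L` is the chord of `u` and `v`, so each remaining center is a combination of the two cubic
  -- points, with nonzero coefficients since it differs from both.
  have hother : ∀ l, l ≠ i → l ≠ j → ∃ a b : ℂ, a ≠ 0 ∧ b ≠ 0 ∧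
      (Q.cam l).toLin (a • paramMap B (cx u) + b • paramMap B (cx v)) = 0 := by
    intro l hli hlj
    obtain ⟨c, hc0, hc⟩ := (Q.cam l).exists_ker
    have hmem := Camera.mem_of_center_mem (hQ l) hc
    rw [← hLspan, Matrix.range_cons, Matrix.range_cons, Matrix.range_empty, Set.union_empty,
      Set.singleton_union, Submodule.mem_span_pair] at hmem
    obtain ⟨a, b, rfl⟩ := hmem
    refine ⟨a, b, ?_, ?_, hc⟩
    · rintro rfl
      refine hlj (Q.distinct (Camera.center_eq_of hc0 hc ?_))
      rw [zero_smul, zero_add, map_smul, hQv, smul_zero]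
    · rintro rfl
      refine hli (Q.distinct (Camera.center_eq_of hc0 hc ?_))
      rw [zero_smul, add_zero, map_smul, hQu, smul_zero]
  let P : Fin n → Camera := fun l => if l = i then P₁ else if l = j then P₂ else Q.cam l
  have hPi : P i = P₁ := by simp [P]
  have hPj : P j = P₂ := by simp [P, hij.symm]
  have hPl : ∀ l, l ≠ i → l ≠ j → P l = Q.cam l := fun l h h' => by simp [P, h, h']
  have hpair := reprojection_pair hB hut hus hts hQu hP₁t hN₂ hP₂
  have hDi : ∀ l, l ≠ i → Distinguishable (Q.cam i) (Q.cam l) (P i) (P l) ∧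
      (P i).center ≠ (P l).center := by
    intro l hl
    by_cases hlj : l = j
    · rw [hlj, hPi, hPj]
      exact hpair
    · obtain ⟨a, b, -, hb, hab⟩ := hother l hl hlj
      rw [hPi, hPl l hl hlj]
      exact reprojection_distinguishable hB huv hut hvt hQu hP₁t hb hab
  have hDj : ∀ l, l ≠ j → Distinguishable (Q.cam j) (Q.cam l) (P j) (P l) ∧
      (P j).center ≠ (P l).center := by
    intro l hl
    by_cases hli : l = i
    · rw [hli, hPi, hPj]
      exact ⟨hpair.1.swap, hpair.2.symm⟩
    · obtain ⟨a, b, ha, -, hab⟩ := hother l hli hl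
      rw [hPj, hPl l hli hl]
      rw [add_comm] at hab
      exact reprojection_distinguishable hB hvu hvs hus hQv hP₂s ha hab
  refine ⟨⟨P, fun a b hab => ?_⟩, fun l z => ?_, fun a b hab h => ?_⟩
  · by_contra hne
    by_cases hai : a = i
    · rw [hai] at hab hne
      exact (hDi b (Ne.symm hne)).2 hab
    by_cases haj : a = j
    · rw [haj] at hab hne
      exact (hDj b (Ne.symm hne)).2 hab
    by_cases hbi : b = i
    · rw [hbi] at hab hne
      exact (hDi a hne).2 hab.symm
    by_cases hbj : b = j
    · rw [hbj] at hab hne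
      exact (hDj a hne).2 hab.symm
    simp only [hPl a hai haj, hPl b hbi hbj] at hab
    exact hne (Q.distinct hab)
  · change ∃ m c d, _ ∧ (P l).toLin _ = _
    by_cases hli : l = i
    · rw [hli, hPi]
      exact ⟨_, _, _, conic_image hN₁ z.1, conic_image hP₁ z.1⟩
    by_cases hlj : l = j
    · rw [hlj, hPj]
      exact ⟨_, _, _, conic_image hN₂ z.1, conic_image hP₂ z.1⟩
    rw [hPl l hli hlj]
    exact ⟨_, 1, 1, (one_smul _ _).symm, (one_smul _ _).symm⟩
  · rcases h with rfl | rfl | rfl | rfl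
    · exact (hDi b hab.symm).1
    · exact (hDj b hab.symm).1
    · exact (hDi a hab).1.swap
    · exact (hDj a hab).1.swap

theorem secantLine_isCritical_and (hn : 2 ≤ n) (hB : IsTwistedCubic B) (hL : IsSecantLine B L)
    (hQ : Q.CentersIn (linePoints L)) {Y : Set P3} (hY : Y ⊆ curve B) :
    IsCritical Q Y ∧
      (n ≤ 3 ∨ Q.AtMostOneCenterIn (curve B) → IsNonTriviallyCritical Q Y) := by
  by_cases hone : Q.AtMostOneCenterIn (curve B)
  · obtain ⟨A, P, -, -, h⟩ := secantLine_conjugateAlong hn hB hL hQ hone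
    have h' := h.isNonTriviallyCritical hY
    obtain ⟨P', X, h''⟩ := h'
    exact ⟨⟨P', X, h''.1⟩, fun _ => ⟨P', X, h''⟩⟩
  · have hone' := hone
    unfold CameraTuple.AtMostOneCenterIn at hone'
    push Not at hone'
    obtain ⟨i, j, hi, hj, hij⟩ := hone'
    obtain ⟨P, hI, hD⟩ := exists_reprojected_cameras hB hL.1 hQ hij hi hj
    rw [curve_eq_range (twistedCubic_paramMap_ne_zero hB)] at hY
    have hc := hI.exists_conjugate (fun z => twistedCubic_paramMap_ne_zero hB z.1 z.2)
      (fun z => twistedCubic_paramMap_ne_zero hB z.1 z.2) (hD i j hij (Or.inl rfl)) Y hY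
    refine ⟨⟨P, _, hc⟩, fun h => ⟨P, _, hc, fun a b hab => (hD a b hab ?_).fundamentalMatrix_ne⟩⟩
    -- With at most three cameras, any two distinct indices include `i` or `j`, so every pair has
    -- been separated.
    have h3 := h.resolve_right hone
    simp only [Fin.ext_iff, ne_eq] at hab hij ⊢
    omega

end Secant

theorem mainTheorem5 (n : ℕ) (hn : 2 ≤ n) :
    -- cameras and points on a smooth rational quartic
    (∀ A : Matrix (Fin 4) (Fin (4 + 1)) ℝ, IsSmoothRationalQuartic A →
      ∀ P : CameraTuple n, P.CentersIn (curve A) →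
        (∀ X ⊆ curve A, IsNonTriviallyCritical P X) ∧
        ∃ (B : Matrix (Fin 4) (Fin (3 + 1)) ℝ) (L : Submodule ℂ (Fin 4 → ℂ)) (Q : CameraTuple n),
          IsTwistedCubic B ∧ IsLine L ∧ Disjoint (linePoints L) (curve B) ∧
          Q.CentersIn (linePoints L) ∧ ConjugateAlong P (curve A) Q (curve B)) ∧
    -- points on a twisted cubic, cameras on a line disjoint from it
    (∀ (B : Matrix (Fin 4) (Fin (3 + 1)) ℝ) (L : Submodule ℂ (Fin 4 → ℂ)),
      IsTwistedCubic B → IsLine L → Disjoint (linePoints L) (curve B) →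
      ∀ Q : CameraTuple n, Q.CentersIn (linePoints L) →
        (∀ Y ⊆ curve B, IsNonTriviallyCritical Q Y) ∧
        ∃ (A : Matrix (Fin 4) (Fin (4 + 1)) ℝ) (P : CameraTuple n),
          IsSmoothRationalQuartic A ∧ P.CentersIn (curve A) ∧
          ConjugateAlong Q (curve B) P (curve A)) ∧
    -- cameras and points on a singular rational quartic
    (∀ A : Matrix (Fin 4) (Fin (4 + 1)) ℝ, IsSingularRationalQuartic A →
      ∀ P : CameraTuple n, P.CentersIn (curve A) →
        (∀ X ⊆ curve A, IsNonTriviallyCritical P X) ∧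
        (P.CentersIn (realBranch A) →
          ∃ (B : Matrix (Fin 4) (Fin (3 + 1)) ℝ) (L : Submodule ℂ (Fin 4 → ℂ))
            (Q : CameraTuple n),
            IsTwistedCubic B ∧ IsSecantLine B L ∧ Q.CentersIn (linePoints L) ∧
            Q.AtMostOneCenterIn (curve B) ∧ ConjugateAlong P (curve A) Q (curve B))) ∧
    -- points on a twisted cubic, cameras on a secant line
    (∀ (B : Matrix (Fin 4) (Fin (3 + 1)) ℝ) (L : Submodule ℂ (Fin 4 → ℂ)),
      IsTwistedCubic B → IsSecantLine B L →
      ∀ Q : CameraTuple n, Q.CentersIn (linePoints L) →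
        (∀ Y ⊆ curve B, IsCritical Q Y) ∧
        (n ≤ 3 ∨ Q.AtMostOneCenterIn (curve B) → ∀ Y ⊆ curve B, IsNonTriviallyCritical Q Y) ∧
        (Q.AtMostOneCenterIn (curve B) →
          ∃ (A : Matrix (Fin 4) (Fin (4 + 1)) ℝ) (P : CameraTuple n),
            IsSingularRationalQuartic A ∧ P.CentersIn (realBranch A) ∧
            ConjugateAlong Q (curve B) P (curve A))) := by
  refine ⟨fun A hA P hP => ?_, fun B L hB hL hdisj Q hQ => ?_, fun A hA P hP => ⟨?_, ?_⟩,
    fun B L hB hL Q hQ => ⟨?_, ?_, ?_⟩⟩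
  · have h := smoothQuartic_conjugateAlong hn hA hP
    refine ⟨fun X hX => ?_, h⟩
    obtain ⟨B, L, Q, -, -, -, -, hQ⟩ := h
    exact hQ.isNonTriviallyCritical hX
  · have h := disjointLine_conjugateAlong hn hB hL hdisj hQ
    refine ⟨fun Y hY => ?_, h⟩
    obtain ⟨A, P, -, -, hP⟩ := h
    exact hP.isNonTriviallyCritical hY
  · exact singularQuartic_isNonTriviallyCritical hn hA hP
  · exact fun h => singularQuartic_conjugateAlong hn hA fun i =>
      exists_of_center_mem_realBranch (h i)
  · exact fun Y hY => (secantLine_isCritical_and hn hB hL hQ hY).1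
  · exact fun h Y hY => (secantLine_isCritical_and hn hB hL hQ hY).2 h
  · exact secantLine_conjugateAlong hn hB hL hQ
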